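/- Let $g$ be a complex function that is holomorphic in a neighbourhood of the half-line $[0,\infty)$, let $f(x)=g(x^2)$ for $x\ge 0$, and let $s\mapsto \bar g^{(s)}(0)$ be a complex function such that the following hold. (1) For all complex $z$ near $0$, $$g(z)=\sum_{m=0}^\infty \frac{\bar g^{(m)}(0)}{m!}\,(-z)^m .$$ (2) $g(x)=O(x^{-d})$ as $x\to+\infty$ along the real axis, for some $d>1/4$. (3) For some $1/4<\delta<1$, the function $\bar g^{(s)}(0)$ is analytic (at every point) on the closed half-plane $H(\delta)=\{s\in\mathbb C:\operatorname{Re}s\ge-\delta\}$, and there are real constants $C$, $P$ and $A<\pi/2$ such that $$|\bar g^{(s)}(0)|<C\,e^{Pv+A|w|}\qquad\text{for all } s=v+iw\in H(\delta).$$ Let $J_0(x)=\sum_{k\ge0}\frac{(-1)^k}{(k!)^2}(x/2)^{2k}$ be the Bessel function of order zero. Then for every $q>0$ and every $\alpha$ with $-1<\alpha<0$ whose line $\operatorname{Re}s=\alpha$ lies in $H(\delta)$ (that is, $-\delta\le\alpha<0$), the zero-order Hankel transform of $f$ converges as an improper integral at infinity, the integral along $\operatorname{Re}s=\alpha$ below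 converges absolutely, and $$\lim_{R\to\infty}\int_0^R J_0(qx)\,f(x)\,x\,dx=\frac{1}{\pi i q^2}\int_{\alpha-i\infty}^{\alpha+i\infty}\bar g^{(s)}(0)\,\Gamma(s+1)\left(\frac{q^2}{4}\right)^{-s}ds .$$ -/

import Mathlib

open Filter Topology MeasureTheory Asymptotics

noncomputable section

/-- The Bessel function of the first kind of order zero on the real line,
`J₀(x) = ∑ₖ (-1)^k / (k!)^2 * (x/2)^(2k)`. -/
def besselJZero (x : ℝ) : ℝ :=
  ∑' k : ℕ, (-1) ^ k / ((Nat.factorial k : ℝ) ^ 2) * (x / 2) ^ (2 * k)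

/-- The series defining `J₀` converges absolutely for every real `x`. -/
theorem summable_besselJZero (x : ℝ) :
    Summable fun k : ℕ => (-1 : ℝ) ^ k / ((Nat.factorial k : ℝ) ^ 2) * (x / 2) ^ (2 * k) := by
  refine Summable.of_norm_bounded (Real.summable_pow_div_factorial ((x / 2) ^ 2)) ?_
  intro k
  have h1 : (1 : ℝ) ≤ (Nat.factorial k : ℝ) := by
    exact_mod_cast Nat.succ_le_of_lt (Nat.factorial_pos k)
  have h2 : (0 : ℝ) ≤ ((x / 2) ^ 2) ^ k := by positivity
  rw [norm_mul, norm_div, norm_pow, norm_neg, norm_one, one_pow, pow_mul,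
    Real.norm_of_nonneg h2, Real.norm_of_nonneg (by positivity), one_div_mul_eq_div]
  apply div_le_div_of_nonneg_left h2 (by linarith)
  nlinarith

/-- `HasHankelTransformZero f q L`: the zero-order Hankel transform
`∫₀^∞ J₀(q x) f(x) x dx` of `f` at `q` exists as an improper integral at infinity,
and its value is `L`. -/
def HasHankelTransformZero (f : ℝ → ℂ) (q : ℝ) (L : ℂ) : Prop :=
  (∀ R : ℝ, 0 < R →
    IntervalIntegrable (fun x : ℝ => (besselJZero (q * x) : ℂ) * f x * (x : ℂ)) volume 0 R) ∧
  Tendsto (fun R : ℝ => ∫ x in (0 : ℝ)..R, (besselJZero (q * x) : ℂ) * f x * (x : ℂ))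
    atTop (𝓝 L)

/-- The integral `∫_{α-i∞}^{α+i∞} F(s) ds` along the upward vertical line `Re s = α`,
parametrized by `s = α + i w`, `ds = i dw`. -/
def verticalLineIntegral (F : ℂ → ℂ) (α : ℝ) : ℂ :=
  Complex.I * ∫ w : ℝ, F ((α : ℂ) + (w : ℂ) * Complex.I)

/-- Absolute convergence of the integral of `F` along the vertical line `Re s = α`. -/
def VerticalLineIntegrable (F : ℂ → ℂ) (α : ℝ) : Prop :=
  Integrable fun w : ℝ => F ((α : ℂ) + (w : ℂ) * Complex.I)

end

/-!
The substitution `y = q² x² / 4` turns the truncated Hankel transform into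
`(2 / q²) ∫₀^Y B(y) g(c y) dy` with `c = 4 / q²` and `B(y) = ∑ (-y)^k / (k!)²` the Bessel–Clifford
function, `J₀(q x) = B(q² x² / 4)`. The proof is a rigorous form of Ramanujan's master theorem.

On `x > 0` the function `g` has the Mellin–Barnes representation
`g(x) = (1 / 2πi) ∫ Γ(-s) gbar(s) x^s ds` along `Re s = -δ` (`eq_mellinBarnes`). Indeed, moving the
line to the right past the poles of `Γ(-s)` at `0, 1, 2, …` produces the Taylor series of `g`, which
is entire and so represents `g` on all of `[0, ∞)`. Crossing the pole at `0` and translating the line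
back replaces `gbar(s)` by `gbar(s + 1) / (s + 1)`, with a factor `-x`, so that only one residue
has to be computed (`mellinBarnes_eq_sub`), and the factorials in the denominators make the
remainder tend to zero. All integrals converge because `Γ` decays like `exp (-θ |Im s|)` for every `θ < π / 2`
(`norm_Gamma_le`, from Euler's integral along a rotated ray), while `gbar` grows at most like
`exp (A |Im s|)` with `A < π / 2`.

Inserting this representation and exchanging the integrals on `0 < y ≤ Y` leaves the truncated
Mellin transforms `M_Y(s) = ∫₀^Y B(y) y^s dy`. For `-1 < Re s < -1/4` two facts about them are
needed: `Γ(-s) M_Y(s) → Γ(s + 1)` as `Y → ∞` (`tendsto_truncatedMellin`), and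
`‖M_Y(s)‖ ≤ K (1 + ‖s‖)` uniformly in `Y` (`exists_norm_truncatedMellin_le`). The first follows from
the Laplace transform `∫₀^∞ B(y) exp (-p y) dy = exp (-1 / p) / p`. Both rest on the bound
`|∫₀^y B| ≤ K y^(1/4)` (`exists_besselClifford_bounds`), which comes from a monotone energy for
Bessel's equation. Since `δ > 1/4`, the line `Re s = -δ` lies in this region, and dominated
convergence gives the formula on it. Finally `gbar(s) Γ(s + 1) c^s` has no poles in `Re s > -1`, so
the line may be moved to `Re s = α` (`integral_Gamma_add_one_line`).
-/

/-! ### Exponential decay of the Gamma function on vertical lines -/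

theorem integrableOn_rpow_mul_exp_neg_mul {v b : ℝ} (hv : -1 < v) (hb : 0 < b) :
    IntegrableOn (fun t : ℝ => t ^ v * Real.exp (-(b * t))) (Set.Ioi 0) := by
  simpa [neg_mul] using integrableOn_rpow_mul_exp_neg_mul_rpow hv one_pos hb

theorem norm_cpow_mul_cexp_neg_mul {a r : ℂ} {t : ℝ} (ht : 0 < t) :
    ‖(t : ℂ) ^ a * Complex.exp (-(r * t))‖ = t ^ a.re * Real.exp (-(r.re * t)) := by
  rw [norm_mul, Complex.norm_cpow_eq_rpow_re_of_pos ht, Complex.norm_exp]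
  simp

theorem integrableOn_cpow_mul_cexp_neg_mul {a r : ℂ} (ha : -1 < a.re) (hr : 0 < r.re) :
    IntegrableOn (fun t : ℝ => (t : ℂ) ^ a * Complex.exp (-(r * t))) (Set.Ioi 0) := by
  refine (integrableOn_rpow_mul_exp_neg_mul ha hr).mono' (by fun_prop) ?_
  filter_upwards [ae_restrict_mem measurableSet_Ioi] with t ht
  exact (norm_cpow_mul_cexp_neg_mul ht).le

theorem differentiableAt_integral_cpow_mul_cexp_neg_mul {a r : ℂ} (ha : 0 < a.re)
    (hr : 0 < r.re) :
    DifferentiableAt ℂ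
      (fun r : ℂ => ∫ t : ℝ in Set.Ioi 0, (t : ℂ) ^ (a - 1) * Complex.exp (-(r * t))) r := by
  have hr2 : 0 < r.re / 2 := by positivity
  refine (hasDerivAt_integral_of_dominated_loc_of_deriv_le
    (F := fun (r : ℂ) (t : ℝ) => (t : ℂ) ^ (a - 1) * Complex.exp (-(r * t)))
    (F' := fun (r : ℂ) (t : ℝ) => (t : ℂ) ^ (a - 1) * (Complex.exp (-(r * t)) * (-t)))
    (bound := fun t : ℝ => t ^ a.re * Real.exp (-(r.re / 2 * t)))
    (Metric.ball_mem_nhds r hr2) (Eventually.of_forall fun _ => by fun_prop)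
    (integrableOn_cpow_mul_cexp_neg_mul (by simpa) hr) (by fun_prop) ?_
    (integrableOn_rpow_mul_exp_neg_mul (by linarith) hr2) ?_).2.differentiableAt
  · filter_upwards [ae_restrict_mem measurableSet_Ioi] with t (ht : 0 < t) z hz
    have hz' : r.re / 2 ≤ z.re := by
      have h1 := Complex.abs_re_le_norm (z - r)
      rw [mem_ball_iff_norm] at hz
      have h2 := (abs_le.1 (h1.trans hz.le)).1
      simp only [Complex.sub_re] at h2
      linarith
    rw [← mul_assoc, norm_mul, norm_cpow_mul_cexp_neg_mul ht, norm_neg, Complex.norm_real,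
      Real.norm_of_nonneg ht.le, mul_right_comm, ← Real.rpow_add_one ht.ne']
    simp only [Complex.sub_re, Complex.one_re, sub_add_cancel]
    gcongr
  · refine Eventually.of_forall fun t z _ => ?_
    have h := ((hasDerivAt_id z).mul_const (t : ℂ)).neg.cexp.const_mul ((t : ℂ) ^ (a - 1))
    simpa using h

/-- Euler's integral for `Γ` with a complex scaling factor `r` in the right half-plane, by analytic
continuation from `r > 0`. -/
theorem integral_cpow_mul_cexp_neg_mul {a r : ℂ} (ha : 0 < a.re) (hr : 0 < r.re) :
    ∫ t : ℝ in Set.Ioi 0, (t : ℂ) ^ (a - 1) * Complex.exp (-(r * t)) =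
      r ^ (-a) * Complex.Gamma a := by
  have hU : IsOpen {z : ℂ | 0 < z.re} := isOpen_lt continuous_const Complex.continuous_re
  have h1 : AnalyticOnNhd ℂ
      (fun r : ℂ => ∫ t : ℝ in Set.Ioi 0, (t : ℂ) ^ (a - 1) * Complex.exp (-(r * t)))
      {z : ℂ | 0 < z.re} :=
    DifferentiableOn.analyticOnNhd (fun z hz =>
      (differentiableAt_integral_cpow_mul_cexp_neg_mul ha hz).differentiableWithinAt) hU
  have h2 : AnalyticOnNhd ℂ (fun r : ℂ => r ^ (-a) * Complex.Gamma a) {z : ℂ | 0 < z.re} := by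
    refine DifferentiableOn.analyticOnNhd (fun z hz => ?_) hU
    exact ((differentiableAt_id.cpow_const (Or.inl hz)).mul_const _).differentiableWithinAt
  refine h1.eqOn_of_preconnected_of_frequently_eq h2 (convex_halfSpace_re_gt 0).isPreconnected
    (z₀ := 1) (by simp) ?_ hr
  -- the two sides agree at `1 + 1 / (n + 1)`, which tends to `1`
  have hlim : Tendsto (fun n : ℕ => ((1 + 1 / ((n : ℝ) + 1) : ℝ) : ℂ)) atTop (𝓝[≠] 1) := by
    refine tendsto_nhdsWithin_iff.2 ⟨?_, Eventually.of_forall fun n => ?_⟩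
    · have h := (tendsto_one_div_add_atTop_nhds_zero_nat (𝕜 := ℝ)).const_add 1
      rw [add_zero] at h
      exact (Complex.continuous_ofReal.tendsto 1).comp h
    · have h : (0 : ℝ) < 1 / ((n : ℝ) + 1) := by positivity
      simp only [Set.mem_compl_iff, Set.mem_singleton_iff]
      intro h3
      have h4 : (1 + 1 / ((n : ℝ) + 1) : ℝ) = 1 := by exact_mod_cast h3
      linarith
  refine hlim.frequently (Eventually.of_forall fun n => ?_).frequently
  have hx : (0 : ℝ) < 1 + 1 / ((n : ℝ) + 1) := by positivity
  rw [Complex.integral_cpow_mul_exp_neg_mul_Ioi ha hx, Complex.cpow_neg, one_div, Complex.inv_cpow]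
  rw [Complex.arg_ofReal_of_nonneg hx.le]
  exact Real.pi_pos.ne

/-- The integral for `Γ` along a ray of angle `θ` shows that `Γ` decays like `exp (-θ |Im s|)` on
vertical lines, for every `θ < π / 2`. -/
theorem norm_Gamma_le {θ : ℝ} (hθ : |θ| < Real.pi / 2) {a : ℂ} (ha : 0 < a.re) :
    ‖Complex.Gamma a‖ ≤
      Real.cos θ ^ (-a.re) * Real.Gamma a.re * Real.exp (-(θ * a.im)) := by
  have hc : 0 < Real.cos θ := Real.cos_pos_of_mem_Ioo ⟨(abs_lt.1 hθ).1, (abs_lt.1 hθ).2⟩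
  set r : ℂ := Complex.exp ((θ : ℂ) * Complex.I) with hrdef
  have hre : r.re = Real.cos θ := Complex.exp_ofReal_mul_I_re θ
  have hr : 0 < r.re := hre ▸ hc
  have h1 := integral_cpow_mul_cexp_neg_mul ha hr
  have hpow : ‖r ^ (-a)‖ = Real.exp (θ * a.im) := by
    have hlog : Complex.log r = (θ : ℂ) * Complex.I := by
      rw [hrdef, Complex.log_exp]
      · simp; linarith [(abs_lt.1 hθ).1, Real.pi_pos]
      · simp; linarith [(abs_lt.1 hθ).2, Real.pi_pos]
    rw [Complex.cpow_def_of_ne_zero (Complex.exp_ne_zero _), hlog, Complex.norm_exp]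
    simp
  have h2 : ‖∫ t : ℝ in Set.Ioi 0, (t : ℂ) ^ (a - 1) * Complex.exp (-(r * t))‖ ≤
      ∫ t : ℝ in Set.Ioi 0, t ^ (a.re - 1) * Real.exp (-(Real.cos θ * t)) := by
    refine norm_integral_le_of_norm_le
      (integrableOn_rpow_mul_exp_neg_mul (by linarith) hc) ?_
    filter_upwards [ae_restrict_mem measurableSet_Ioi] with t ht
    rw [norm_cpow_mul_cexp_neg_mul ht, hre]
    simp
  rw [h1, norm_mul, hpow, Real.integral_rpow_mul_exp_neg_mul_Ioi ha hc, one_div,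
    Real.inv_rpow hc.le, ← Real.rpow_neg hc.le] at h2
  rw [Real.exp_neg, ← div_eq_mul_inv, le_div_iff₀ (Real.exp_pos _), mul_comm]
  exact h2

/-- Uniform version of `norm_Gamma_le` on a vertical strip. -/
theorem exists_norm_Gamma_le {θ a b : ℝ} (hθ0 : 0 ≤ θ) (hθ : θ < Real.pi / 2) (ha : 0 < a) :
    ∃ K : ℝ, 0 ≤ K ∧ ∀ s : ℂ, a ≤ s.re → s.re ≤ b →
      ‖Complex.Gamma s‖ ≤ K * Real.exp (-(θ * |s.im|)) := by
  have hc : 0 < Real.cos θ := Real.cos_pos_of_mem_Ioo ⟨by linarith [Real.pi_pos], hθ⟩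
  have hcont : ContinuousOn (fun v : ℝ => Real.cos θ ^ (-v) * Real.Gamma v) (Set.Icc a b) := by
    refine ContinuousOn.mul ?_ ?_
    · exact (Real.continuous_const_rpow hc.ne').comp_continuousOn continuous_neg.continuousOn
    · intro v hv
      refine (Real.differentiableAt_Gamma fun m => ?_).continuousAt.continuousWithinAt
      have : (0 : ℝ) ≤ m := m.cast_nonneg
      linarith [hv.1]
  obtain ⟨K, hK⟩ := isCompact_Icc.exists_bound_of_continuousOn hcont
  refine ⟨max K 0, le_max_right _ _, fun s hs1 hs2 => ?_⟩
  have hK' : Real.cos θ ^ (-s.re) * Real.Gamma s.re ≤ max K 0 :=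
    (le_abs_self _).trans ((hK s.re ⟨hs1, hs2⟩).trans (le_max_left _ _))
  have hs : 0 < s.re := ha.trans_le hs1
  rcases le_total 0 s.im with him | him
  · rw [abs_of_nonneg him]
    refine (norm_Gamma_le (by rwa [abs_of_nonneg hθ0]) hs).trans ?_
    gcongr
  · rw [abs_of_nonpos him]
    have h := norm_Gamma_le (θ := -θ) (by rwa [abs_neg, abs_of_nonneg hθ0]) hs
    rw [Real.cos_neg, neg_mul_comm] at h
    refine h.trans ?_
    gcongr

/-! ### Shifting vertical lines of integration -/

/-- Cauchy's theorem for an infinite vertical strip. -/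
theorem integral_vertical_line_eq {F : ℂ → ℂ} {a b : ℝ} (hab : a ≤ b)
    (hF : DifferentiableOn ℂ F {s : ℂ | a ≤ s.re ∧ s.re ≤ b}) {B : ℝ → ℝ}
    (hB : Tendsto B atTop (𝓝 0))
    (hFB : ∀ s : ℂ, a ≤ s.re → s.re ≤ b → 1 ≤ |s.im| → ‖F s‖ ≤ B |s.im|)
    (hFa : Integrable fun w : ℝ => F ((a : ℂ) + (w : ℂ) * Complex.I))
    (hFb : Integrable fun w : ℝ => F ((b : ℂ) + (w : ℂ) * Complex.I)) :
    ∫ w : ℝ, F ((a : ℂ) + (w : ℂ) * Complex.I) = ∫ w : ℝ, F ((b : ℂ) + (w : ℂ) * Complex.I) := by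
  have hla := intervalIntegral_tendsto_integral hFa tendsto_neg_atTop_atBot tendsto_id
  have hlb := intervalIntegral_tendsto_integral hFb tendsto_neg_atTop_atBot tendsto_id
  have hlim := (hlb.sub hla).const_mul Complex.I
  have hhor : ∀ T : ℝ, 1 ≤ |T| →
      ‖∫ x in a..b, F ((x : ℂ) + (T : ℂ) * Complex.I)‖ ≤ B |T| * |b - a| := by
    intro T hT
    refine intervalIntegral.norm_integral_le_of_norm_le_const fun x hx => ?_
    rw [Set.uIoc_of_le hab] at hx
    have := hFB ((x : ℂ) + (T : ℂ) * Complex.I) (by simpa using hx.1.le) (by simpa using hx.2)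
      (by simpa using hT)
    simpa using this
  have hzero : Tendsto (fun T : ℝ => Complex.I *
      ((∫ w in (-T)..T, F ((b : ℂ) + (w : ℂ) * Complex.I)) -
        ∫ w in (-T)..T, F ((a : ℂ) + (w : ℂ) * Complex.I))) atTop (𝓝 0) := by
    have hBb : Tendsto (fun T => B T * |b - a| + B T * |b - a|) atTop (𝓝 0) := by
      simpa using (hB.mul_const |b - a|).add (hB.mul_const |b - a|)
    refine squeeze_zero_norm' ?_ hBb
    filter_upwards [eventually_ge_atTop 1] with T hT
    have hrect := Complex.integral_boundary_rect_eq_zero_of_differentiableOn F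
      ((a : ℂ) + ((-T : ℝ) : ℂ) * Complex.I) ((b : ℂ) + (T : ℂ) * Complex.I) (by
        refine hF.mono fun s hs => ?_
        have := hs.1
        simpa [Set.uIcc_of_le hab] using this)
    simp only [Complex.add_re, Complex.ofReal_re, Complex.mul_re, Complex.I_re, mul_zero,
      Complex.ofReal_im, Complex.I_im, mul_one, sub_self, add_zero, Complex.add_im,
      Complex.mul_im, zero_add, smul_eq_mul] at hrect
    have h1 := hhor T (hT.trans (le_abs_self T))
    have h2 := hhor (-T) (by rw [abs_neg]; exact hT.trans (le_abs_self T))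
    rw [abs_neg] at h2
    rw [abs_of_nonneg (by linarith : (0 : ℝ) ≤ T)] at h1 h2
    have heq : Complex.I * ((∫ w in (-T)..T, F ((b : ℂ) + (w : ℂ) * Complex.I)) -
        ∫ w in (-T)..T, F ((a : ℂ) + (w : ℂ) * Complex.I)) =
        (∫ x in a..b, F ((x : ℂ) + (T : ℂ) * Complex.I)) -
          ∫ x in a..b, F ((x : ℂ) + ((-T : ℝ) : ℂ) * Complex.I) := by
      linear_combination hrect
    rw [heq]
    exact (norm_sub_le _ _).trans (add_le_add h1 h2)
  have h := tendsto_nhds_unique hlim hzero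
  rw [mul_eq_zero, or_iff_right Complex.I_ne_zero, sub_eq_zero] at h
  exact h.symm

theorem integrable_exp_neg_mul_abs {ε : ℝ} (hε : 0 < ε) :
    Integrable fun w : ℝ => Real.exp (-(ε * |w|)) := by
  have h : IntegrableOn (fun w : ℝ => Real.exp (-(ε * |w|))) (Set.Ioi 0) := by
    refine (exp_neg_integrableOn_Ioi 0 hε).congr_fun (fun w (hw : 0 < w) => ?_) measurableSet_Ioi
    simp [abs_of_pos hw]
  rw [← integrableOn_univ, ← Set.Iic_union_Ioi (a := (0 : ℝ)), integrableOn_union]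
  refine ⟨?_, h⟩
  rw [integrableOn_Iic_iff_integrableOn_Iio, ← neg_zero, ← Set.neg_Ioi,
    ← integrable_indicator_iff measurableSet_Ioi.neg]
  have h2 := (h.integrable_indicator measurableSet_Ioi).comp_neg
  refine h2.congr (Eventually.of_forall fun w => ?_)
  simp [Set.indicator]

theorem inv_sq_add_sq_eq {c : ℝ} (hc : c ≠ 0) (w : ℝ) :
    (c ^ 2 + w ^ 2)⁻¹ = (c ^ 2)⁻¹ * (1 + (w / c) ^ 2)⁻¹ := by
  rw [← mul_inv]
  field_simp

theorem integrable_inv_sq_add_sq {c : ℝ} (hc : c ≠ 0) :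
    Integrable fun w : ℝ => (c ^ 2 + w ^ 2)⁻¹ := by
  simp_rw [inv_sq_add_sq_eq hc]
  exact (integrable_inv_one_add_sq.comp_div hc).const_mul _

theorem integral_univ_inv_sq_add_sq {c : ℝ} (hc : c ≠ 0) :
    ∫ w : ℝ, (c ^ 2 + w ^ 2)⁻¹ = Real.pi / |c| := by
  simp_rw [inv_sq_add_sq_eq hc]
  rw [integral_const_mul, Measure.integral_comp_div (fun x : ℝ => (1 + x ^ 2)⁻¹) c,
    integral_univ_inv_one_add_sq, smul_eq_mul, ← sq_abs c]
  have : |c| ≠ 0 := abs_ne_zero.2 hc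
  field_simp

theorem vertical_line_ne_zero {c : ℝ} (hc : c ≠ 0) (w : ℝ) : (c : ℂ) + (w : ℂ) * Complex.I ≠ 0 := by
  intro h
  exact hc (by simpa using congrArg Complex.re h)

theorem norm_sq_vertical_line (c w : ℝ) : ‖(c : ℂ) + (w : ℂ) * Complex.I‖ ^ 2 = c ^ 2 + w ^ 2 := by
  rw [← Complex.normSq_eq_norm_sq, Complex.normSq_add_mul_I]

theorem integrable_inv_sub_inv_vertical_line {c c' : ℝ} (hc : c ≠ 0) (hc' : c' ≠ 0) :
    Integrable fun w : ℝ =>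
      ((c : ℂ) + (w : ℂ) * Complex.I)⁻¹ - ((c' : ℂ) + (w : ℂ) * Complex.I)⁻¹ := by
  have h := ((integrable_inv_sq_add_sq hc).add (integrable_inv_sq_add_sq hc')).const_mul |c' - c|
  refine h.mono' (by fun_prop) (Eventually.of_forall fun w => ?_)
  have h1 := vertical_line_ne_zero hc w
  have h2 := vertical_line_ne_zero hc' w
  have hn1 : 0 < ‖(c : ℂ) + (w : ℂ) * Complex.I‖ := norm_pos_iff.2 h1
  have hn2 : 0 < ‖(c' : ℂ) + (w : ℂ) * Complex.I‖ := norm_pos_iff.2 h2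
  rw [inv_sub_inv h1 h2, add_sub_add_right_eq_sub, norm_div, norm_mul, ← Complex.ofReal_sub,
    Complex.norm_real, Real.norm_eq_abs, div_eq_mul_inv]
  refine mul_le_mul_of_nonneg_left ?_ (abs_nonneg _)
  simp only [Pi.add_apply]
  rw [← norm_sq_vertical_line, ← norm_sq_vertical_line, mul_inv, ← inv_pow, ← inv_pow]
  nlinarith [sq_nonneg (‖(c : ℂ) + (w : ℂ) * Complex.I‖⁻¹ - ‖(c' : ℂ) + (w : ℂ) * Complex.I‖⁻¹),
    inv_pos.2 hn1, inv_pos.2 hn2, mul_pos (inv_pos.2 hn1) (inv_pos.2 hn2)]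

/-- Only the even parts `c / (c² + w²)` of the two reciprocals contribute to the integral. -/
theorem integral_inv_sub_inv_vertical_line {c c' : ℝ} (hc : c ≠ 0) (hc' : c' ≠ 0) :
    ∫ w : ℝ, (((c : ℂ) + (w : ℂ) * Complex.I)⁻¹ - ((c' : ℂ) + (w : ℂ) * Complex.I)⁻¹) =
      ((Real.pi * (c / |c|) - Real.pi * (c' / |c'|) : ℝ) : ℂ) := by
  set f : ℝ → ℂ := fun w =>
    ((c : ℂ) + (w : ℂ) * Complex.I)⁻¹ - ((c' : ℂ) + (w : ℂ) * Complex.I)⁻¹ with hf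
  have hint : Integrable f := integrable_inv_sub_inv_vertical_line hc hc'
  have hneg : ∫ w, f (-w) = ∫ w, f w := integral_neg_eq_self f volume
  have hsum : ∫ w, (f w + f (-w)) =
      ((∫ w : ℝ, (2 * c * (c ^ 2 + w ^ 2)⁻¹ - 2 * c' * (c' ^ 2 + w ^ 2)⁻¹) : ℝ) : ℂ) := by
    rw [← integral_complex_ofReal]
    refine integral_congr_ae (Eventually.of_forall fun w => ?_)
    have aux : ∀ d : ℝ, d ≠ 0 → ((d : ℂ) + (w : ℂ) * Complex.I)⁻¹ +
        ((d : ℂ) + ((-w : ℝ) : ℂ) * Complex.I)⁻¹ = ((2 * d * (d ^ 2 + w ^ 2)⁻¹ : ℝ) : ℂ) := by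
      intro d hd
      have h1 := vertical_line_ne_zero hd w
      have h2 := vertical_line_ne_zero hd (-w)
      have h3 : (d : ℂ) ^ 2 + (w : ℂ) ^ 2 =
          ((d : ℂ) + (w : ℂ) * Complex.I) * ((d : ℂ) + ((-w : ℝ) : ℂ) * Complex.I) := by
        push_cast
        linear_combination (w : ℂ) ^ 2 * Complex.I_sq
      rw [inv_add_inv h1 h2]
      push_cast [h3]
      rw [div_eq_mul_inv]
      congr 1
      ring
    have e1 := aux c hc
    have e2 := aux c' hc'
    simp only [hf]
    push_cast at e1 e2 ⊢
    linear_combination e1 - e2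
  rw [integral_add hint hint.comp_neg, hneg] at hsum
  rw [integral_sub ((integrable_inv_sq_add_sq hc).const_mul _)
    ((integrable_inv_sq_add_sq hc').const_mul _), integral_const_mul, integral_const_mul,
    integral_univ_inv_sq_add_sq hc, integral_univ_inv_sq_add_sq hc'] at hsum
  have h2 : (2 : ℂ) * ∫ w, f w = 2 * ((Real.pi * (c / |c|) - Real.pi * (c' / |c'|) : ℝ) : ℂ) := by
    rw [two_mul, hsum]
    push_cast
    ring
  exact mul_left_cancel₀ two_ne_zero h2

theorem continuous_vertical_line (c : ℝ) :
    Continuous fun w : ℝ => (c : ℂ) + (w : ℂ) * Complex.I := by fun_prop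

theorem integrable_vertical_line_of_le {F : ℂ → ℂ} {c K ε : ℝ} (hε : 0 < ε)
    (hF : Continuous fun w : ℝ => F ((c : ℂ) + (w : ℂ) * Complex.I))
    (hb : ∀ w : ℝ, ‖F ((c : ℂ) + (w : ℂ) * Complex.I)‖ ≤ K * Real.exp (-(ε * |w|))) :
    Integrable fun w : ℝ => F ((c : ℂ) + (w : ℂ) * Complex.I) :=
  ((integrable_exp_neg_mul_abs hε).const_mul K).mono' hF.aestronglyMeasurable
    (Eventually.of_forall hb)

theorem continuous_comp_vertical_line {F : ℂ → ℂ} {a b c : ℝ}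
    (hF : ContinuousOn F {s : ℂ | a ≤ s.re ∧ s.re ≤ b}) (hac : a ≤ c) (hcb : c ≤ b) :
    Continuous fun w : ℝ => F ((c : ℂ) + (w : ℂ) * Complex.I) :=
  hF.comp_continuous (continuous_vertical_line c) fun w => by simp [hac, hcb]

/-- The residue theorem for a simple pole at `0` in a vertical strip. Subtracting `G 0 / (s + 1)`
from `G` removes the pole and leaves an elementary correction term. -/
theorem integral_vertical_line_div_sub {G : ℂ → ℂ} {a b K ε : ℝ} (ha1 : -1 < a) (ha : a < 0)
    (hb : 0 < b) (hG : DifferentiableOn ℂ G {s : ℂ | a ≤ s.re ∧ s.re ≤ b}) (hε : 0 < ε)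
    (hK : ∀ s : ℂ, a ≤ s.re → s.re ≤ b → ‖G s‖ ≤ K * Real.exp (-(ε * |s.im|))) :
    (∫ w : ℝ, G ((b : ℂ) + (w : ℂ) * Complex.I) / ((b : ℂ) + (w : ℂ) * Complex.I)) -
      ∫ w : ℝ, G ((a : ℂ) + (w : ℂ) * Complex.I) / ((a : ℂ) + (w : ℂ) * Complex.I) =
      2 * Real.pi * G 0 := by
  have hK0 : 0 ≤ K := by
    have := (norm_nonneg _).trans (hK 0 (by simpa using ha.le) (by simpa using hb.le))
    simpa using this
  set S : Set ℂ := {s : ℂ | a ≤ s.re ∧ s.re ≤ b}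
  set H : ℂ → ℂ := fun s => G s - G 0 / (s + 1) with hH
  have hH0 : H 0 = 0 := by simp [hH]
  have hS : S ∈ 𝓝 (0 : ℂ) := by
    have h1 : ∀ᶠ s : ℂ in 𝓝 0, a < s.re :=
      Complex.continuous_re.continuousAt.eventually_const_lt (by simpa using ha)
    have h2 : ∀ᶠ s : ℂ in 𝓝 0, s.re < b :=
      Complex.continuous_re.continuousAt.eventually_lt_const (by simpa using hb)
    filter_upwards [h1, h2] with s h1 h2 using ⟨h1.le, h2.le⟩
  have hne1 : ∀ s ∈ S, s + 1 ≠ 0 := by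
    intro s hs h
    have : s.re + 1 = 0 := by simpa using congrArg Complex.re h
    linarith [hs.1]
  have hHd : DifferentiableOn ℂ (dslope H 0) S := by
    rw [Complex.differentiableOn_dslope hS]
    exact hG.sub ((differentiableOn_const _).div (differentiableOn_id.add_const 1) hne1)
  have hE : ∀ s ∈ S, s ≠ 0 → dslope H 0 s = G s / s - G 0 * (s⁻¹ - (s + 1)⁻¹) := by
    intro s hs h0
    have := hne1 s hs
    rw [dslope_of_ne _ h0, slope_def_field, hH0]
    simp only [hH]
    field_simp
    ring
  have hmem : ∀ c : ℝ, a ≤ c → c ≤ b → ∀ w : ℝ, (c : ℂ) + (w : ℂ) * Complex.I ∈ S := by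
    intro c h1 h2 w
    simp [S, h1, h2]
  -- on a line `Re s = c` with `c ≠ 0` the integral splits
  have hline : ∀ c : ℝ, a ≤ c → c ≤ b → c ≠ 0 →
      Integrable (fun w : ℝ => dslope H 0 ((c : ℂ) + (w : ℂ) * Complex.I)) ∧
      ∫ w : ℝ, dslope H 0 ((c : ℂ) + (w : ℂ) * Complex.I) =
        (∫ w : ℝ, G ((c : ℂ) + (w : ℂ) * Complex.I) / ((c : ℂ) + (w : ℂ) * Complex.I)) -
          G 0 * ((Real.pi * (c / |c|) - Real.pi : ℝ) : ℂ) := by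
    intro c hac hcb hc0
    have hc1 : 0 < c + 1 := by linarith
    have i1 : Integrable fun w : ℝ =>
        G ((c : ℂ) + (w : ℂ) * Complex.I) / ((c : ℂ) + (w : ℂ) * Complex.I) := by
      refine integrable_vertical_line_of_le (F := fun s => G s / s) (K := K / |c|) hε
        ((continuous_comp_vertical_line hG.continuousOn hac hcb).div₀
          (continuous_vertical_line c) (vertical_line_ne_zero hc0)) fun w => ?_
      have h1 := hK _ (hmem c hac hcb w).1 (hmem c hac hcb w).2
      have h2 : |c| ≤ ‖(c : ℂ) + (w : ℂ) * Complex.I‖ := by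
        simpa using Complex.abs_re_le_norm ((c : ℂ) + (w : ℂ) * Complex.I)
      have h3 : 0 < |c| := abs_pos.2 hc0
      rw [norm_div, div_mul_eq_mul_div]
      refine div_le_div₀ (by positivity) ?_ h3 h2
      simpa using h1
    have i2 := (integrable_inv_sub_inv_vertical_line hc0 hc1.ne').const_mul (G 0)
    have hval : ∀ w : ℝ, dslope H 0 ((c : ℂ) + (w : ℂ) * Complex.I) =
        G ((c : ℂ) + (w : ℂ) * Complex.I) / ((c : ℂ) + (w : ℂ) * Complex.I) -
        G 0 * (((c : ℂ) + (w : ℂ) * Complex.I)⁻¹ -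
          (((c + 1 : ℝ) : ℂ) + (w : ℂ) * Complex.I)⁻¹) := by
      intro w
      rw [hE _ (hmem c hac hcb w) (vertical_line_ne_zero hc0 w)]
      push_cast
      ring_nf
    simp_rw [hval]
    refine ⟨i1.sub i2, ?_⟩
    rw [integral_sub i1 i2, integral_const_mul, integral_inv_sub_inv_vertical_line hc0 hc1.ne',
      abs_of_pos hc1, div_self hc1.ne', mul_one]
  obtain ⟨ia, ea⟩ := hline a le_rfl (ha.le.trans hb.le) ha.ne
  obtain ⟨ib, eb⟩ := hline b (ha.le.trans hb.le) le_rfl hb.ne'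
  have hB : Tendsto (fun t : ℝ => (K + ‖G 0‖ ) * t⁻¹) atTop (𝓝 0) := by
    simpa using tendsto_inv_atTop_zero.const_mul (K + ‖G 0‖)
  have key := integral_vertical_line_eq (ha.le.trans hb.le) hHd hB (by
    intro s h1 h2 him
    have h0 : s ≠ 0 := by
      rintro rfl
      norm_num at him
    have hp : 0 < |s.im| := by linarith
    have hn : |s.im| ≤ ‖s‖ := Complex.abs_im_le_norm s
    have hn1 : 1 ≤ ‖s + 1‖ := him.trans (by simpa using Complex.abs_im_le_norm (s + 1))
    rw [dslope_of_ne _ h0, slope_def_field, hH0, sub_zero, sub_zero, norm_div, div_eq_mul_inv]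
    have hb1 : ‖G s‖ ≤ K := by
      refine (hK s h1 h2).trans (mul_le_of_le_one_right hK0 ?_)
      rw [Real.exp_le_one_iff]
      nlinarith
    have hb2 : ‖H s‖ ≤ K + ‖G 0‖ := by
      refine (norm_sub_le _ _).trans (add_le_add hb1 ?_)
      rw [norm_div]
      exact div_le_self (norm_nonneg _) hn1
    gcongr) ia ib
  rw [ea, eb, abs_of_neg ha, abs_of_pos hb, div_self hb.ne', div_neg, div_self ha.ne] at key
  push_cast at key
  linear_combination -key

/-! ### The Mellin–Barnes representation of `g` -/

/-- `φ` is analytic on the half-plane `Re s ≥ -δ` and bounded there by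
`C exp (P Re s + A |Im s|)`. -/
structure ExpBounded (δ A P C : ℝ) (φ : ℂ → ℂ) : Prop where
  analytic : AnalyticOnNhd ℂ φ {s : ℂ | -δ ≤ s.re}
  bound : ∀ s : ℂ, -δ ≤ s.re → ‖φ s‖ ≤ C * Real.exp (P * s.re + A * |s.im|)

/-- Since `A < π / 2`, the decay of `Γ` beats the growth `exp (A |Im s|)`. The variable `z` stands
for `-s`, `1 - s` or `s + 1`; the constants depend neither on `y` nor on `C`. -/
theorem exists_norm_Gamma_mul_cpow_le {A P x a b l u : ℝ} (hA : A < Real.pi / 2) (hx : 0 < x)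
    (hl : 0 < l) :
    ∃ ε : ℝ, 0 < ε ∧ ∃ K : ℝ, 0 ≤ K ∧ ∀ (C : ℝ) (y s z : ℂ),
      ‖y‖ ≤ C * Real.exp (P * s.re + A * |s.im|) → a ≤ s.re → s.re ≤ b → l ≤ z.re → z.re ≤ u →
      |z.im| = |s.im| → ‖Complex.Gamma z * y * (x : ℂ) ^ s‖ ≤ C * K * Real.exp (-(ε * |s.im|)) := by
  obtain ⟨θ, hθ1, hθ2⟩ := exists_between (max_lt hA (by positivity : 0 < Real.pi / 2))
  have hθ0 : 0 ≤ θ := (le_max_right A 0).trans hθ1.le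
  have hθA : A < θ := (le_max_left A 0).trans_lt hθ1
  obtain ⟨K, hK0, hK⟩ := exists_norm_Gamma_le (b := u) hθ0 hθ2 hl
  have hcont : ContinuousOn (fun v : ℝ => Real.exp (P * v) * x ^ v) (Set.Icc a b) :=
    ((by fun_prop : Continuous fun v : ℝ => Real.exp (P * v)).mul
      (Real.continuous_const_rpow hx.ne')).continuousOn
  obtain ⟨M, hM⟩ := isCompact_Icc.exists_bound_of_continuousOn hcont
  refine ⟨θ - A, sub_pos.2 hθA, K * max M 0, mul_nonneg hK0 (le_max_right _ _), ?_⟩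
  intro C y s z hy h1 h2 h3 h4 h5
  have hC : 0 ≤ C := nonneg_of_mul_nonneg_left ((norm_nonneg _).trans hy) (Real.exp_pos _)
  have hM' : Real.exp (P * s.re) * x ^ s.re ≤ max M 0 :=
    (le_abs_self _).trans ((hM s.re ⟨h1, h2⟩).trans (le_max_left _ _))
  have hΓ := hK z h3 h4
  rw [h5] at hΓ
  rw [norm_mul, norm_mul, Complex.norm_cpow_eq_rpow_re_of_pos hx]
  calc ‖Complex.Gamma z‖ * ‖y‖ * x ^ s.re
      ≤ (K * Real.exp (-(θ * |s.im|))) * (C * Real.exp (P * s.re + A * |s.im|)) * x ^ s.re := by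
        gcongr
    _ = C * K * (Real.exp (P * s.re) * x ^ s.re) * Real.exp (-((θ - A) * |s.im|)) := by
        rw [Real.exp_add, show -((θ - A) * |s.im|) = -(θ * |s.im|) + A * |s.im| by ring,
          Real.exp_add]
        ring
    _ ≤ C * K * max M 0 * Real.exp (-((θ - A) * |s.im|)) := by gcongr
    _ = _ := by ring

theorem differentiableAt_Gamma_of_re_pos {s : ℂ} (hs : 0 < s.re) :
    DifferentiableAt ℂ Complex.Gamma s := by
  refine Complex.differentiableAt_Gamma s fun m h => ?_
  have h1 := congrArg Complex.re h
  simp only [Complex.neg_re, Complex.natCast_re] at h1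
  have : (0 : ℝ) ≤ m := m.cast_nonneg
  linarith

theorem differentiable_const_cpow {x : ℝ} (hx : 0 < x) :
    Differentiable ℂ fun s : ℂ => (x : ℂ) ^ s := fun s =>
  differentiableAt_id.const_cpow (Or.inl (by exact_mod_cast hx.ne'))

/-- The Mellin–Barnes integral `(1 / 2πi) ∫ Γ(-s) φ(s) x ^ s ds` along `Re s = -δ`. -/
noncomputable def mellinBarnes (δ : ℝ) (φ : ℂ → ℂ) (x : ℝ) : ℂ :=
  (2 * (Real.pi : ℂ))⁻¹ * ∫ w : ℝ,
    Complex.Gamma (-((-δ : ℝ) + (w : ℂ) * Complex.I)) * φ ((-δ : ℝ) + (w : ℂ) * Complex.I) *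
      (x : ℂ) ^ (((-δ : ℝ) : ℂ) + (w : ℂ) * Complex.I)

/-- The function that replaces `φ` when the line of integration crosses the pole of `Γ(-s)` at `0`
and is moved back by `1`. -/
noncomputable def poleShift (φ : ℂ → ℂ) (s : ℂ) : ℂ := φ (s + 1) / (s + 1)

theorem Gamma_neg_eq_div {s : ℂ} (hs : s ≠ 0) :
    Complex.Gamma (-s) = -Complex.Gamma (1 - s) / s := by
  have h := Complex.Gamma_add_one (-s) (neg_ne_zero.2 hs)
  rw [show 1 - s = -s + 1 by ring, h]
  field_simp

/-- The residue of the integrand at `s = 0`; the line `Re s = 1 - δ` is parametrized by `s + 1`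
with `Re s = -δ`. -/
theorem mellinBarnes_eq_sub {δ A P C : ℝ} (hδ : 0 < δ) (hδ1 : δ < 1) (hA : A < Real.pi / 2)
    {φ : ℂ → ℂ} (hφ : ExpBounded δ A P C φ) {x : ℝ} (hx : 0 < x) :
    mellinBarnes δ φ x = φ 0 - x * mellinBarnes δ (poleShift φ) x := by
  obtain ⟨ε, hε, K, -, hK⟩ := exists_norm_Gamma_mul_cpow_le (P := P) (a := -δ) (b := 1 - δ)
    (u := 1 + δ) hA hx hδ
  set G : ℂ → ℂ := fun s => -(Complex.Gamma (1 - s) * φ s * (x : ℂ) ^ s) with hG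
  have hGd : DifferentiableOn ℂ G {s : ℂ | -δ ≤ s.re ∧ s.re ≤ 1 - δ} := by
    intro s hs
    refine DifferentiableAt.differentiableWithinAt (DifferentiableAt.fun_neg ?_)
    refine DifferentiableAt.mul (DifferentiableAt.mul ?_ (hφ.analytic s hs.1).differentiableAt)
      (differentiable_const_cpow hx s)
    refine DifferentiableAt.comp s (differentiableAt_Gamma_of_re_pos ?_)
      (differentiableAt_id.const_sub 1)
    have := hs.2
    simp only [Complex.sub_re, Complex.one_re]
    linarith
  have hres := integral_vertical_line_div_sub (a := -δ) (b := 1 - δ) (G := G) (K := C * K)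
    (by linarith) (by linarith) (by linarith) hGd hε (by
      intro s h1 h2
      rw [hG, norm_neg]
      refine hK C (φ s) s (1 - s) (hφ.bound s h1) h1 h2 ?_ ?_ ?_
      · simp only [Complex.sub_re, Complex.one_re]; linarith
      · simp only [Complex.sub_re, Complex.one_re]; linarith
      · simp)
  have hG0 : G 0 = -φ 0 := by simp [hG]
  have ha : ∀ w : ℝ, G (((-δ : ℝ) : ℂ) + (w : ℂ) * Complex.I) /
      (((-δ : ℝ) : ℂ) + (w : ℂ) * Complex.I) =
      Complex.Gamma (-((-δ : ℝ) + (w : ℂ) * Complex.I)) * φ ((-δ : ℝ) + (w : ℂ) * Complex.I) *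
      (x : ℂ) ^ (((-δ : ℝ) : ℂ) + (w : ℂ) * Complex.I) := by
    intro w
    rw [Gamma_neg_eq_div (vertical_line_ne_zero (neg_ne_zero.2 hδ.ne') w)]
    simp only [hG]
    ring
  have hb : ∀ w : ℝ, G (((1 - δ : ℝ) : ℂ) + (w : ℂ) * Complex.I) /
      (((1 - δ : ℝ) : ℂ) + (w : ℂ) * Complex.I) =
      -(x : ℂ) * (Complex.Gamma (-((-δ : ℝ) + (w : ℂ) * Complex.I)) *
        poleShift φ ((-δ : ℝ) + (w : ℂ) * Complex.I) *
        (x : ℂ) ^ (((-δ : ℝ) : ℂ) + (w : ℂ) * Complex.I)) := by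
    intro w
    have hx0 : (x : ℂ) ≠ 0 := by exact_mod_cast hx.ne'
    rw [show (((1 - δ : ℝ) : ℂ) + (w : ℂ) * Complex.I) =
      (((-δ : ℝ) : ℂ) + (w : ℂ) * Complex.I) + 1 by push_cast; ring]
    generalize (((-δ : ℝ) : ℂ) + (w : ℂ) * Complex.I) = s
    simp only [hG, poleShift]
    rw [Complex.cpow_add _ _ hx0, Complex.cpow_one, show 1 - (s + 1) = -s by ring]
    ring
  simp_rw [ha, hb] at hres
  rw [integral_const_mul, hG0] at hres
  have hpi : (2 * (Real.pi : ℂ))⁻¹ * (2 * Real.pi) = 1 :=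
    inv_mul_cancel₀ (mul_ne_zero two_ne_zero (by exact_mod_cast Real.pi_ne_zero))
  unfold mellinBarnes
  linear_combination (-(2 * (Real.pi : ℂ))⁻¹) * hres + φ 0 * hpi

theorem integrable_mellinBarnes {δ A P C : ℝ} (hδ : 0 < δ) (hA : A < Real.pi / 2) {φ : ℂ → ℂ}
    (hφ : ExpBounded δ A P C φ) {x : ℝ} (hx : 0 < x) :
    Integrable fun w : ℝ =>
      Complex.Gamma (-((-δ : ℝ) + (w : ℂ) * Complex.I)) * φ ((-δ : ℝ) + (w : ℂ) * Complex.I) *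
      (x : ℂ) ^ (((-δ : ℝ) : ℂ) + (w : ℂ) * Complex.I) := by
  obtain ⟨ε, hε, K, -, hK⟩ := exists_norm_Gamma_mul_cpow_le (P := P) (a := -δ) (b := -δ)
    (u := δ) hA hx hδ
  refine integrable_vertical_line_of_le (F := fun s => Complex.Gamma (-s) * φ s * (x : ℂ) ^ s)
    (K := C * K) hε ?_ fun w => ?_
  · refine continuous_comp_vertical_line (a := -δ) (b := -δ)
      (F := fun s => Complex.Gamma (-s) * φ s * (x : ℂ) ^ s) ?_ le_rfl le_rfl
    intro s hs
    refine ContinuousAt.continuousWithinAt (ContinuousAt.mul (ContinuousAt.mul ?_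
      (hφ.analytic s hs.1).continuousAt) (differentiable_const_cpow hx s).continuousAt)
    refine ContinuousAt.comp (differentiableAt_Gamma_of_re_pos ?_).continuousAt
      continuous_neg.continuousAt
    have := hs.2
    simp only [Complex.neg_re]
    linarith
  · have := hK C _ (((-δ : ℝ) : ℂ) + (w : ℂ) * Complex.I) (-(((-δ : ℝ) : ℂ) + (w : ℂ) * Complex.I))
      (hφ.bound _ (by simp)) (by simp) (by simp) (by simp) (by simp) (by simp)
    simpa using this

/-- A bound that is linear in `C`, uniformly in `φ`. -/
theorem exists_norm_mellinBarnes_le {δ A P x : ℝ} (hδ : 0 < δ) (hA : A < Real.pi / 2)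
    (hx : 0 < x) :
    ∃ K : ℝ, ∀ (C : ℝ) (φ : ℂ → ℂ), ExpBounded δ A P C φ → ‖mellinBarnes δ φ x‖ ≤ C * K := by
  obtain ⟨ε, hε, K, -, hK⟩ := exists_norm_Gamma_mul_cpow_le (P := P) (a := -δ) (b := -δ)
    (u := δ) hA hx hδ
  refine ⟨‖(2 * (Real.pi : ℂ))⁻¹‖ * (K * ∫ w : ℝ, Real.exp (-(ε * |w|))), fun C φ hφ => ?_⟩
  have hint := (integrable_exp_neg_mul_abs hε).const_mul (C * K)
  have h := norm_integral_le_of_norm_le hint (f := fun w : ℝ =>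
      Complex.Gamma (-((-δ : ℝ) + (w : ℂ) * Complex.I)) * φ ((-δ : ℝ) + (w : ℂ) * Complex.I) *
      (x : ℂ) ^ (((-δ : ℝ) : ℂ) + (w : ℂ) * Complex.I)) (Eventually.of_forall fun w => by
    have := hK C _ (((-δ : ℝ) : ℂ) + (w : ℂ) * Complex.I) (-(((-δ : ℝ) : ℂ) + (w : ℂ) * Complex.I))
      (hφ.bound _ (by simp)) (by simp) (by simp) (by simp) (by simp) (by simp)
    simpa using this)
  rw [integral_const_mul] at h
  rw [mellinBarnes, norm_mul]
  calc _ ≤ ‖(2 * (Real.pi : ℂ))⁻¹‖ * (C * K * ∫ w : ℝ, Real.exp (-(ε * |w|))) := by gcongr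
    _ = _ := by ring

/-- The `N`-fold iterate of `poleShift`, in closed form. -/
noncomputable def poleShiftIter (φ : ℂ → ℂ) (N : ℕ) (s : ℂ) : ℂ :=
  φ (s + N) / ∏ j ∈ Finset.range N, (s + (j + 1))

theorem poleShift_poleShiftIter (φ : ℂ → ℂ) (N : ℕ) :
    poleShift (poleShiftIter φ N) = poleShiftIter φ (N + 1) := by
  ext s
  simp only [poleShift, poleShiftIter, Finset.prod_range_succ', Nat.cast_zero, zero_add,
    div_div]
  congr 1
  · congr 1; push_cast; ring
  · congr 1
    refine Finset.prod_congr rfl fun j _ => ?_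
    push_cast; ring

theorem poleShiftIter_zero_right (φ : ℂ → ℂ) (N : ℕ) :
    poleShiftIter φ N 0 = φ N / (N.factorial : ℂ) := by
  rw [← Finset.prod_range_add_one_eq_factorial]
  simp only [poleShiftIter, zero_add]
  push_cast
  rfl

theorem ExpBounded.poleShiftIter {δ A P C : ℝ} (hδ1 : δ < 1) {φ : ℂ → ℂ}
    (hφ : ExpBounded δ A P C φ) (N : ℕ) :
    ExpBounded δ A P (C * Real.exp P ^ N / ∏ j ∈ Finset.range N, ((j : ℝ) + 1 - δ))
      (poleShiftIter φ N) := by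
  have hre : ∀ s : ℂ, -δ ≤ s.re → ∀ j : ℕ, (j : ℝ) + 1 - δ ≤ ‖s + (j + 1)‖ := by
    intro s hs j
    refine le_trans ?_ (Complex.re_le_norm _)
    simp only [Complex.add_re, Complex.natCast_re, Complex.one_re]
    linarith
  have hpos : ∀ j : ℕ, 0 < (j : ℝ) + 1 - δ := fun j => by
    have : (0 : ℝ) ≤ j := j.cast_nonneg
    linarith
  have hsN : ∀ s : ℂ, -δ ≤ s.re → -δ ≤ (s + N).re := fun s hs => by
    have : (0 : ℝ) ≤ N := N.cast_nonneg
    simp only [Complex.add_re, Complex.natCast_re]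
    linarith
  refine ⟨fun s hs => ?_, fun s hs => ?_⟩
  · refine AnalyticAt.div ?_ ?_ ?_
    · exact AnalyticAt.fun_comp (f := fun z : ℂ => z + N) (hφ.analytic (s + N) (hsN s hs))
        (analyticAt_id.add analyticAt_const)
    · exact Finset.analyticAt_fun_prod _ fun j _ => analyticAt_id.add analyticAt_const
    · refine Finset.prod_ne_zero_iff.2 fun j _ => norm_pos_iff.1 ?_
      exact (hpos j).trans_le (hre s hs j)
  · have h1 := hφ.bound (s + N) (hsN s hs)
    have h2 : ∏ j ∈ Finset.range N, ((j : ℝ) + 1 - δ) ≤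
        ‖∏ j ∈ Finset.range N, (s + ((j : ℂ) + 1))‖ := by
      rw [norm_prod]
      exact Finset.prod_le_prod (fun j _ => (hpos j).le) fun j _ => hre s hs j
    have h3 : 0 < ∏ j ∈ Finset.range N, ((j : ℝ) + 1 - δ) := Finset.prod_pos fun j _ => hpos j
    rw [_root_.poleShiftIter, norm_div, div_mul_eq_mul_div]
    refine div_le_div₀ ((norm_nonneg _).trans (h1.trans_eq ?_)) (h1.trans_eq ?_) h3 h2
    all_goals
      simp only [Complex.add_re, Complex.natCast_re, Complex.add_im, Complex.natCast_im, add_zero]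
      rw [mul_assoc, ← Real.exp_nat_mul, ← Real.exp_add]
      ring_nf

theorem mellinBarnes_eq_sum_add {δ A P C : ℝ} (hδ : 0 < δ) (hδ1 : δ < 1) (hA : A < Real.pi / 2)
    {φ : ℂ → ℂ} (hφ : ExpBounded δ A P C φ) {x : ℝ} (hx : 0 < x) (N : ℕ) :
    mellinBarnes δ φ x = ∑ m ∈ Finset.range N, φ m / (m.factorial : ℂ) * (-(x : ℂ)) ^ m +
      (-(x : ℂ)) ^ N * mellinBarnes δ (poleShiftIter φ N) x := by
  induction N with
  | zero =>
    have : poleShiftIter φ 0 = φ := by ext s; simp [poleShiftIter]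
    simp [this]
  | succ N ih =>
    rw [ih, mellinBarnes_eq_sub hδ hδ1 hA (hφ.poleShiftIter hδ1 N) hx, poleShift_poleShiftIter,
      poleShiftIter_zero_right, Finset.sum_range_succ, pow_succ]
    ring

theorem mul_factorial_le_prod_range {δ : ℝ} (hδ1 : δ < 1) (N : ℕ) :
    (1 - δ) * N.factorial ≤ ∏ j ∈ Finset.range (N + 1), ((j : ℝ) + 1 - δ) := by
  induction N with
  | zero => simp
  | succ N ih =>
    rw [Finset.prod_range_succ, Nat.factorial_succ]
    have h0 : (0 : ℝ) < 1 - δ := by linarith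
    have h1 : (0 : ℝ) ≤ N := N.cast_nonneg
    push_cast
    calc (1 - δ) * (((N : ℝ) + 1) * N.factorial) = (1 - δ) * N.factorial * (N + 1) := by ring
      _ ≤ _ := by
        refine mul_le_mul ih (by linarith) (by linarith) (le_trans (by positivity) ih)

/-- The remainder after `N` poles is `O((x exp P)^N / (N - 1)!)`. -/
theorem tendsto_sum_mellinBarnes {δ A P C : ℝ} (hδ : 0 < δ) (hδ1 : δ < 1) (hA : A < Real.pi / 2)
    {φ : ℂ → ℂ} (hφ : ExpBounded δ A P C φ) {x : ℝ} (hx : 0 < x) :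
    Tendsto (fun N : ℕ => ∑ m ∈ Finset.range N, φ m / (m.factorial : ℂ) * (-(x : ℂ)) ^ m) atTop
      (𝓝 (mellinBarnes δ φ x)) := by
  obtain ⟨K, hK⟩ := exists_norm_mellinBarnes_le (P := P) hδ hA hx
  have hrem : Tendsto (fun N : ℕ => (-(x : ℂ)) ^ N * mellinBarnes δ (poleShiftIter φ N) x) atTop
      (𝓝 0) := by
    rw [← tendsto_add_atTop_iff_nat 1]
    have hlim : Tendsto (fun N : ℕ => |C| * |K| * (x * Real.exp P) / (1 - δ) *
        ((x * Real.exp P) ^ N / (N.factorial : ℝ))) atTop (𝓝 0) := by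
      simpa using (FloorSemiring.tendsto_pow_div_factorial_atTop (x * Real.exp P)).const_mul
        (|C| * |K| * (x * Real.exp P) / (1 - δ))
    refine squeeze_zero_norm (fun N => ?_) hlim
    have h1 := hK _ _ (hφ.poleShiftIter hδ1 (N + 1))
    have h2 := mul_factorial_le_prod_range hδ1 N
    have h3 : (0 : ℝ) < (1 - δ) * N.factorial := mul_pos (by linarith) (by positivity)
    have h4 : C * Real.exp P ^ (N + 1) / (∏ j ∈ Finset.range (N + 1), ((j : ℝ) + 1 - δ)) * K ≤
        |C| * Real.exp P ^ (N + 1) / ((1 - δ) * N.factorial) * |K| := by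
      refine (le_abs_self _).trans ?_
      rw [abs_mul, abs_div, abs_mul, abs_of_pos (h3.trans_le h2),
        abs_of_pos (pow_pos (Real.exp_pos P) _)]
      gcongr
    rw [norm_mul, norm_pow, norm_neg, Complex.norm_real, Real.norm_of_nonneg hx.le]
    calc x ^ (N + 1) * ‖mellinBarnes δ (poleShiftIter φ (N + 1)) x‖
        ≤ x ^ (N + 1) * (|C| * Real.exp P ^ (N + 1) / ((1 - δ) * N.factorial) * |K|) := by
          gcongr
          exact h1.trans h4
      _ = _ := by
          rw [mul_pow]
          field_simp
          ring
  have h := (tendsto_const_nhds (x := mellinBarnes δ φ x)).sub hrem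
  rw [sub_zero] at h
  refine h.congr fun N => ?_
  rw [mellinBarnes_eq_sum_add hδ hδ1 hA hφ hx N]
  ring

/-- The Taylor series of `g` at `0` represents `g` on the whole half-line, since it is entire. -/
theorem hasSum_of_expBounded {δ A P C : ℝ} (hδ : 0 < δ) {g φ : ℂ → ℂ}
    (hφ : ExpBounded δ A P C φ) (hg : ∀ x : ℝ, 0 ≤ x → AnalyticAt ℂ g (x : ℂ))
    (hTaylor : ∀ᶠ z : ℂ in 𝓝 0,
      HasSum (fun m : ℕ => φ (m : ℂ) / (Nat.factorial m : ℂ) * (-z) ^ m) (g z))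
    {x : ℝ} (hx : 0 ≤ x) :
    HasSum (fun m : ℕ => φ (m : ℂ) / (Nat.factorial m : ℂ) * (-(x : ℂ)) ^ m) (g x) := by
  have hle : ∀ (R : ℝ) (m : ℕ) (z : ℂ), ‖z‖ ≤ R →
      ‖φ (m : ℂ) / (Nat.factorial m : ℂ) * (-z) ^ m‖ ≤
        C * ((Real.exp P * R) ^ m / (m.factorial : ℝ)) := by
    intro R m z hz
    have h0 : (0 : ℝ) ≤ m := m.cast_nonneg
    have h1 := hφ.bound m (by simp only [Complex.natCast_re]; linarith)
    simp only [Complex.natCast_re, Complex.natCast_im, abs_zero, mul_zero, add_zero] at h1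
    rw [mul_comm P, Real.exp_nat_mul] at h1
    rw [norm_mul, norm_div, norm_pow, norm_neg, Complex.norm_natCast]
    calc ‖φ m‖ / m.factorial * ‖z‖ ^ m ≤ C * Real.exp P ^ m / m.factorial * R ^ m := by
          have := (norm_nonneg _).trans h1
          gcongr
      _ = _ := by rw [mul_pow]; ring
  have hsum : ∀ R : ℝ, Summable fun m : ℕ => C * ((Real.exp P * R) ^ m / (m.factorial : ℝ)) :=
    fun R => (Real.summable_pow_div_factorial _).mul_left C
  set S : ℂ → ℂ := fun z => ∑' m : ℕ, φ (m : ℂ) / (Nat.factorial m : ℂ) * (-z) ^ m with hS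
  have hSsum : ∀ z : ℂ, HasSum (fun m : ℕ => φ (m : ℂ) / (Nat.factorial m : ℂ) * (-z) ^ m) (S z) :=
    fun z => (Summable.of_norm_bounded (hsum ‖z‖) fun m => hle ‖z‖ m z le_rfl).hasSum
  have hSa : ∀ z : ℂ, AnalyticAt ℂ S z := by
    intro z
    have hd : DifferentiableOn ℂ S (Metric.ball 0 (‖z‖ + 1)) := by
      refine Complex.differentiableOn_tsum_of_summable_norm (hsum (‖z‖ + 1)) (fun m => ?_)
        Metric.isOpen_ball fun m w hw => hle _ m w (by simpa using (mem_ball_zero_iff.1 hw).le)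
      fun_prop
    exact hd.analyticAt (Metric.isOpen_ball.mem_nhds (by simp))
  have hpre : IsPreconnected (Complex.ofReal '' Set.Ici 0) :=
    isPreconnected_Ici.image _ Complex.continuous_ofReal.continuousOn
  have heq : Set.EqOn g S (Complex.ofReal '' Set.Ici 0) := by
    refine AnalyticOnNhd.eqOn_of_preconnected_of_eventuallyEq (z₀ := 0) ?_ (fun z _ => hSa z) hpre
      ⟨0, by simp, by simp⟩ ?_
    · rintro _ ⟨y, hy, rfl⟩
      exact hg y hy
    · filter_upwards [hTaylor] with z hz
      exact hz.unique (hSsum z)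
  rw [heq ⟨x, hx, rfl⟩]
  exact hSsum x

/-- Ramanujan's master theorem in inverted form. -/
theorem eq_mellinBarnes {δ A P C : ℝ} (hδ : 0 < δ) (hδ1 : δ < 1) (hA : A < Real.pi / 2)
    {g φ : ℂ → ℂ} (hφ : ExpBounded δ A P C φ) (hg : ∀ x : ℝ, 0 ≤ x → AnalyticAt ℂ g (x : ℂ))
    (hTaylor : ∀ᶠ z : ℂ in 𝓝 0,
      HasSum (fun m : ℕ => φ (m : ℂ) / (Nat.factorial m : ℂ) * (-z) ^ m) (g z))
    {x : ℝ} (hx : 0 < x) : g x = mellinBarnes δ φ x :=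
  tendsto_nhds_unique (hasSum_of_expBounded hδ hφ hg hTaylor hx.le).tendsto_sum_nat
    (tendsto_sum_mellinBarnes hδ hδ1 hA hφ hx)

/-! ### The Bessel–Clifford function -/

/-- The Bessel–Clifford function `∑ₖ (-y)^k / (k!)^2`; it equals `J₀(2√y)` for `y ≥ 0`. -/
noncomputable def besselClifford (y : ℝ) : ℝ :=
  ∑' k : ℕ, (-1) ^ k / ((k.factorial : ℝ) ^ 2) * y ^ k

/-- The function `∑ₖ (-1)^k y^(k+1) / (k! (k+1)!)`, the primitive of `besselClifford` that vanishes
at `0`; it equals `√y J₁(2√y)` for `y ≥ 0`. -/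
noncomputable def besselCliffordPrimitive (y : ℝ) : ℝ :=
  y * ∑' k : ℕ, (-1) ^ k / ((k.factorial : ℝ) * ((k + 1).factorial : ℝ)) * y ^ k

theorem besselJZero_eq_besselClifford (x : ℝ) : besselJZero x = besselClifford (x ^ 2 / 4) := by
  refine tsum_congr fun k => ?_
  rw [pow_mul]
  congr 2
  ring

theorem summable_mul_pow_of_le {a : ℕ → ℝ} (ha : ∀ k, |a k| ≤ 1 / (k.factorial : ℝ)) (y : ℝ) :
    Summable fun k => a k * y ^ k := by
  refine Summable.of_norm_bounded (Real.summable_pow_div_factorial |y|) fun k => ?_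
  rw [norm_mul, norm_pow, Real.norm_eq_abs, Real.norm_eq_abs, div_eq_mul_one_div, mul_comm]
  gcongr
  exact ha k

/-- Termwise differentiation, with the derived series reindexed to start at `y ^ 0`. -/
theorem hasDerivAt_tsum_mul_pow {a : ℕ → ℝ} (ha : ∀ k, |a k| ≤ 1 / (k.factorial : ℝ)) (y : ℝ) :
    HasDerivAt (fun y => ∑' k, a k * y ^ k) (∑' k, a (k + 1) * (k + 1) * y ^ k) y := by
  have hu : Summable fun k : ℕ => (k : ℝ) / (k.factorial : ℝ) * (|y| + 1) ^ (k - 1) := by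
    rw [← summable_nat_add_iff 1]
    refine (Real.summable_pow_div_factorial (|y| + 1)).congr fun k => ?_
    rw [Nat.factorial_succ, Nat.add_sub_cancel]
    push_cast
    field_simp
  have hb : ∀ (k : ℕ) (z : ℝ), z ∈ Metric.ball (0 : ℝ) (|y| + 1) →
      ‖a k * (k * z ^ (k - 1))‖ ≤ (k : ℝ) / (k.factorial : ℝ) * (|y| + 1) ^ (k - 1) := by
    intro k z hz
    have hz' : |z| ≤ |y| + 1 := by simpa using (mem_ball_zero_iff.1 hz).le
    rw [norm_mul, norm_mul, norm_pow, Real.norm_eq_abs, Real.norm_eq_abs, Real.norm_eq_abs,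
      Nat.abs_cast]
    calc |a k| * (k * |z| ^ (k - 1)) ≤ 1 / (k.factorial : ℝ) * (k * (|y| + 1) ^ (k - 1)) := by
          gcongr
          exact ha k
      _ = _ := by ring
  have hy : y ∈ Metric.ball (0 : ℝ) (|y| + 1) := by simp
  have h := hasDerivAt_tsum_of_isPreconnected hu Metric.isOpen_ball
    (convex_ball (0 : ℝ) (|y| + 1)).isPreconnected
    (fun k z _ => (hasDerivAt_pow k z).const_mul (a k)) hb hy (summable_mul_pow_of_le ha y) hy
  have hs : Summable fun k : ℕ => a k * (k * y ^ (k - 1)) :=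
    Summable.of_norm_bounded hu fun k => hb k y hy
  rw [hs.tsum_eq_zero_add] at h
  simpa [mul_assoc] using h

theorem abs_neg_one_pow_div_factorial_sq_le (k : ℕ) :
    |(-1) ^ k / ((k.factorial : ℝ) ^ 2)| ≤ 1 / (k.factorial : ℝ) := by
  have h1 : (1 : ℝ) ≤ k.factorial := by exact_mod_cast Nat.succ_le_of_lt k.factorial_pos
  rw [abs_div, abs_pow, abs_neg, abs_one, one_pow, abs_of_pos (by positivity)]
  gcongr
  nlinarith

theorem hasDerivAt_besselClifford {y : ℝ} (hy : 0 < y) :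
    HasDerivAt besselClifford (-besselCliffordPrimitive y / y) y := by
  have h := hasDerivAt_tsum_mul_pow abs_neg_one_pow_div_factorial_sq_le y
  have e : -besselCliffordPrimitive y / y =
      ∑' k : ℕ, (-1) ^ (k + 1) / (((k + 1).factorial : ℝ) ^ 2) * (k + 1) * y ^ k := by
    rw [besselCliffordPrimitive, neg_div, mul_div_cancel_left₀ _ hy.ne', ← tsum_neg]
    refine tsum_congr fun k => ?_
    rw [Nat.factorial_succ]
    push_cast
    field_simp
    ring
  rw [e]
  exact h

theorem hasDerivAt_besselCliffordPrimitive (y : ℝ) :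
    HasDerivAt besselCliffordPrimitive (besselClifford y) y := by
  set b : ℕ → ℝ := fun k =>
    if k = 0 then 0 else (-1) ^ (k - 1) / (((k - 1).factorial : ℝ) * (k.factorial : ℝ)) with hb
  have hb' : ∀ k : ℕ, b (k + 1) =
      (-1) ^ k / ((k.factorial : ℝ) * ((k + 1).factorial : ℝ)) := fun k => by simp [hb]
  have hbound : ∀ k, |b k| ≤ 1 / (k.factorial : ℝ) := by
    rintro (_ | k)
    · simp [hb]
    · have h1 : (1 : ℝ) ≤ k.factorial := by exact_mod_cast Nat.succ_le_of_lt k.factorial_pos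
      have h2 : (0 : ℝ) < (k + 1).factorial := by exact_mod_cast (k + 1).factorial_pos
      rw [hb', abs_div, abs_pow, abs_neg, abs_one, one_pow, abs_of_pos (by positivity)]
      gcongr
      nlinarith
  have h := hasDerivAt_tsum_mul_pow hbound y
  have e1 : besselCliffordPrimitive = fun y => ∑' k, b k * y ^ k := by
    ext z
    rw [(summable_mul_pow_of_le hbound z).tsum_eq_zero_add, besselCliffordPrimitive, ← tsum_mul_left]
    have h0 : b 0 = 0 := if_pos rfl
    rw [h0, zero_mul, zero_add]
    refine tsum_congr fun k => ?_
    rw [hb']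
    ring
  have e2 : besselClifford y = ∑' k, b (k + 1) * (k + 1) * y ^ k := by
    refine tsum_congr fun k => ?_
    rw [hb', Nat.factorial_succ]
    push_cast
    field_simp
  rw [e1, e2]
  exact h

theorem continuous_besselClifford : Continuous besselClifford :=
  continuous_iff_continuousAt.2 fun y =>
    (hasDerivAt_tsum_mul_pow abs_neg_one_pow_div_factorial_sq_le y).continuousAt

/-- The energy `(Φ - B/4)² + (y + 1/16) B²`, with `B = besselClifford` and `Φ` its primitive; it is
`√y` times the energy `(du/dx)² + (1 + 1/(4x²)) u²` of the solution `u = y^(1/4) B(y)`, `x = 2√y`, of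
the normal form `u'' + (1 + 1/(4x²)) u = 0` of Bessel's equation. -/
noncomputable def besselEnergy (y : ℝ) : ℝ :=
  (besselCliffordPrimitive y - besselClifford y / 4) ^ 2 + (y + 1 / 16) * besselClifford y ^ 2

/-- By `Φ' = B` and `y B' = -Φ` the derivative is `-B² / (16 y √y)`. -/
theorem antitoneOn_besselEnergy_div_sqrt :
    AntitoneOn (fun y => besselEnergy y / √y) (Set.Ici 1) := by
  have hd : ∀ y : ℝ, 0 < y → HasDerivAt (fun y => besselEnergy y / √y)
      (-besselClifford y ^ 2 / 16 / (y * √y)) y := by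
    intro y hy
    have hB := hasDerivAt_besselClifford hy
    have hΦ := hasDerivAt_besselCliffordPrimitive y
    have hs := Real.hasDerivAt_sqrt hy.ne'
    have hs0 : 0 < √y := Real.sqrt_pos.2 hy
    have hE := ((((hΦ.sub (hB.div_const 4)).pow 2).add
      (((hasDerivAt_id y).add_const (1 / 16)).mul (hB.pow 2))).div hs hs0.ne')
    refine hE.congr_deriv ?_
    have hsq : √y ^ 2 = y := Real.sq_sqrt hy.le
    simp only [Pi.add_apply, Pi.sub_apply, Pi.mul_apply, Pi.pow_apply, id]
    rw [hsq]
    field_simp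
    rw [hsq]
    ring
  refine antitoneOn_of_deriv_nonpos (convex_Ici 1) ?_ ?_ ?_
  · intro y hy
    exact (hd y (one_pos.trans_le hy)).continuousAt.continuousWithinAt
  · intro y hy
    rw [interior_Ici] at hy
    exact (hd y (one_pos.trans hy)).differentiableAt.differentiableWithinAt
  · intro y hy
    rw [interior_Ici] at hy
    have hy0 : 0 < y := one_pos.trans hy
    rw [(hd y hy0).deriv, neg_div, neg_div]
    exact neg_nonpos.2 (by positivity)

/-- `besselClifford` is bounded and its primitive is `O(y^(1/4))` on the half-line. -/
theorem exists_besselClifford_bounds :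
    ∃ K : ℝ, 0 ≤ K ∧ (∀ y : ℝ, 0 ≤ y → |besselClifford y| ≤ K) ∧
      ∀ y : ℝ, 0 ≤ y → |besselCliffordPrimitive y| ≤ K * y ^ (1 / 4 : ℝ) := by
  obtain ⟨M₁, hM₁⟩ := isCompact_Icc (a := (0 : ℝ)) (b := 1) |>.exists_bound_of_continuousOn
    continuous_besselClifford.continuousOn
  set Q := besselEnergy 1
  have hQ : ∀ y : ℝ, 1 ≤ y → besselEnergy y ≤ Q * √y := by
    intro y hy
    have h := antitoneOn_besselEnergy_div_sqrt (Set.mem_Ici.2 le_rfl) (Set.mem_Ici.2 hy) hy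
    simp only [Real.sqrt_one, div_one] at h
    rwa [div_le_iff₀ (Real.sqrt_pos.2 (by linarith))] at h
  have hM₁0 : 0 ≤ M₁ := (norm_nonneg _).trans (hM₁ 0 (by simp))
  have hQ0 : 0 ≤ Q := by simp only [Q, besselEnergy]; positivity
  have h3Q : M₁ ≤ max M₁ √(3 * Q) := le_max_left _ _
  refine ⟨max M₁ √(3 * Q), hM₁0.trans h3Q, fun y hy => ?_, fun y hy => ?_⟩
  · rcases le_total y 1 with h1 | h1
    · exact (hM₁ y ⟨hy, h1⟩).trans h3Q
    · refine le_trans ?_ (le_max_right _ _)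
      refine Real.abs_le_sqrt ?_
      have h2 := hQ y h1
      have h4 : √y ≤ y := by
        rw [Real.sqrt_le_left (by linarith)]
        nlinarith
      have h5 : y * besselClifford y ^ 2 ≤ y * Q := by
        have : besselEnergy y ≤ Q * y := h2.trans (by gcongr)
        unfold besselEnergy at this
        nlinarith [sq_nonneg (besselCliffordPrimitive y - besselClifford y / 4),
          sq_nonneg (besselClifford y)]
      have h6 := le_of_mul_le_mul_left h5 (by linarith)
      linarith
  · rcases le_total y 1 with h1 | h1
    · -- the mean value inequality, as `Φ' = B` and `Φ 0 = 0`
      have h2 : ‖besselCliffordPrimitive y - besselCliffordPrimitive 0‖ ≤ M₁ * ‖y - 0‖ := by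
        refine (convex_Icc (0 : ℝ) 1).norm_image_sub_le_of_norm_hasDerivWithin_le
          (fun z _ => (hasDerivAt_besselCliffordPrimitive z).hasDerivWithinAt)
          (fun z hz => hM₁ z hz) (by simp) ⟨hy, h1⟩
      have h0 : besselCliffordPrimitive 0 = 0 := by simp [besselCliffordPrimitive]
      rw [h0, sub_zero, sub_zero, Real.norm_eq_abs, Real.norm_eq_abs, abs_of_nonneg hy] at h2
      have h4 : y ≤ y ^ (1 / 4 : ℝ) := by
        rcases hy.eq_or_lt with rfl | hy'
        · simp
        · simpa using Real.rpow_le_rpow_of_exponent_ge hy' h1 (by norm_num : (1 / 4 : ℝ) ≤ 1)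
      exact h2.trans (by gcongr)
    · have h2 := hQ y h1
      have h4 : (y ^ (1 / 4 : ℝ)) ^ 2 = √y := by
        rw [← Real.rpow_natCast, ← Real.rpow_mul (by linarith), Real.sqrt_eq_rpow]
        norm_num
      refine le_trans ?_ (mul_le_mul_of_nonneg_right (le_max_right _ _) (Real.rpow_nonneg hy _))
      refine abs_le_of_sq_le_sq ?_ (by positivity)
      rw [mul_pow, Real.sq_sqrt (by positivity), h4]
      unfold besselEnergy at h2
      nlinarith [sq_nonneg (besselCliffordPrimitive y - besselClifford y / 2),
        sq_nonneg (besselClifford y), sq_nonneg (besselCliffordPrimitive y - besselClifford y / 4)]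

/-! ### The Mellin transform of the Bessel–Clifford function -/

theorem norm_intervalIntegral_le_integral_Ioi {E : Type*} [NormedAddCommGroup E] [NormedSpace ℝ E]
    {f : ℝ → E} {h : ℝ → ℝ} {a Y : ℝ} (haY : a ≤ Y) (hf : ∀ y, a < y → ‖f y‖ ≤ h y)
    (hh : IntegrableOn h (Set.Ioi a)) :
    ‖∫ y in a..Y, f y‖ ≤ ∫ y in Set.Ioi a, h y := by
  rw [intervalIntegral.integral_of_le haY]
  have h1 : ‖∫ y in Set.Ioc a Y, f y‖ ≤ ∫ y in Set.Ioc a Y, h y := by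
    refine norm_integral_le_of_norm_le (hh.mono_set Set.Ioc_subset_Ioi_self) ?_
    filter_upwards [ae_restrict_mem measurableSet_Ioc] with y hy using hf y hy.1
  refine h1.trans (setIntegral_mono_set hh ?_ Set.Ioc_subset_Ioi_self.eventuallyLE)
  filter_upwards [ae_restrict_mem measurableSet_Ioi] with y hy
  exact (norm_nonneg _).trans (hf y hy)

theorem integral_pow_mul_exp_neg_mul {p : ℝ} (hp : 0 < p) (k : ℕ) :
    ∫ y in Set.Ioi (0 : ℝ), y ^ k * Real.exp (-(p * y)) = p⁻¹ ^ (k + 1) * k.factorial := by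
  have h := Real.integral_rpow_mul_exp_neg_mul_Ioi (a := (k : ℝ) + 1) (by positivity) hp
  rw [Real.Gamma_nat_eq_factorial, one_div] at h
  simp only [add_sub_cancel_right, Real.rpow_natCast] at h
  rw [h]
  norm_cast

theorem integrableOn_pow_mul_exp_neg_mul {p : ℝ} (hp : 0 < p) (k : ℕ) :
    IntegrableOn (fun y : ℝ => y ^ k * Real.exp (-(p * y))) (Set.Ioi 0) := by
  have h := integrableOn_rpow_mul_exp_neg_mul (v := k) (by linarith [k.cast_nonneg (α := ℝ)]) hp
  simpa using h

/-- Weber's first exponential integral. -/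
theorem integral_besselClifford_mul_exp {p : ℝ} (hp : 0 < p) :
    ∫ y in Set.Ioi (0 : ℝ), besselClifford y * Real.exp (-(p * y)) =
      p⁻¹ * Real.exp (-p⁻¹) := by
  set F : ℕ → ℝ → ℝ := fun k y =>
    (-1) ^ k / ((k.factorial : ℝ) ^ 2) * (y ^ k * Real.exp (-(p * y))) with hF
  have hint : ∀ k, Integrable (F k) (volume.restrict (Set.Ioi 0)) := fun k =>
    (integrableOn_pow_mul_exp_neg_mul hp k).const_mul _
  have hval : ∀ k, ∫ y in Set.Ioi (0 : ℝ), F k y = p⁻¹ * ((-p⁻¹) ^ k / (k.factorial : ℝ)) := by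
    intro k
    have : (k.factorial : ℝ) ≠ 0 := by positivity
    simp only [hF]
    rw [integral_const_mul, integral_pow_mul_exp_neg_mul hp, neg_pow p⁻¹ k, pow_succ p⁻¹ k]
    field_simp
  have hnorm : ∀ k, ∫ y in Set.Ioi (0 : ℝ), ‖F k y‖ = p⁻¹ * (p⁻¹ ^ k / (k.factorial : ℝ)) := by
    intro k
    have h0 : (k.factorial : ℝ) ≠ 0 := by positivity
    have : ∀ y ∈ Set.Ioi (0 : ℝ), ‖F k y‖ =
        1 / ((k.factorial : ℝ) ^ 2) * (y ^ k * Real.exp (-(p * y))) := by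
      intro y (hy : 0 < y)
      simp only [hF]
      rw [norm_mul, norm_div, norm_pow, norm_neg, norm_one, one_pow,
        Real.norm_of_nonneg (by positivity), Real.norm_of_nonneg (by positivity)]
    rw [setIntegral_congr_fun measurableSet_Ioi this, integral_const_mul,
      integral_pow_mul_exp_neg_mul hp, pow_succ p⁻¹ k]
    field_simp
  have h := hasSum_integral_of_summable_integral_norm hint (by
    simp_rw [hnorm]
    exact (Real.summable_pow_div_factorial p⁻¹).mul_left _)
  have hexp : HasSum (fun k : ℕ => p⁻¹ * ((-p⁻¹) ^ k / (k.factorial : ℝ)))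
      (p⁻¹ * Real.exp (-p⁻¹)) := by
    rw [Real.exp_eq_exp_ℝ]
    exact (NormedSpace.expSeries_div_hasSum_exp (-p⁻¹)).mul_left _
  simp_rw [hval] at h
  rw [← h.unique hexp]
  refine integral_congr_ae (Eventually.of_forall fun y => ?_)
  simp only [hF, besselClifford]
  rw [← tsum_mul_right]
  exact tsum_congr fun k => mul_assoc _ _ _

theorem integrableOn_besselClifford_mul_exp {p : ℝ} (hp : 0 < p) :
    IntegrableOn (fun y => besselClifford y * Real.exp (-(p * y))) (Set.Ioi 0) := by
  obtain ⟨K, -, hB, -⟩ := exists_besselClifford_bounds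
  have h := (integrableOn_pow_mul_exp_neg_mul hp 0).const_mul K
  have hc := continuous_besselClifford
  refine h.mono' (by fun_prop) ?_
  filter_upwards [ae_restrict_mem measurableSet_Ioi] with y (hy : 0 < y)
  rw [norm_mul, Real.norm_of_nonneg (Real.exp_pos _).le, pow_zero, one_mul]
  gcongr
  exact hB y hy.le

theorem tendsto_integral_besselClifford_mul_exp {p : ℝ} (hp : 0 < p) :
    Tendsto (fun Y => ∫ y in (0 : ℝ)..Y, besselClifford y * Real.exp (-(p * y))) atTop
      (𝓝 (p⁻¹ * Real.exp (-p⁻¹))) := by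
  rw [← integral_besselClifford_mul_exp hp]
  exact intervalIntegral_tendsto_integral_Ioi 0 (integrableOn_besselClifford_mul_exp hp) tendsto_id

theorem rpow_quarter_mul_exp_neg_le {t : ℝ} (ht : 0 ≤ t) :
    t ^ (1 / 4 : ℝ) * Real.exp (-t) ≤ 1 := by
  have h1 : t ^ (1 / 4 : ℝ) ≤ Real.exp t := by
    refine le_trans ?_ (Real.add_one_le_exp t)
    rcases le_total t 1 with h | h
    · exact (Real.rpow_le_one ht h (by norm_num)).trans (by linarith)
    · exact (Real.rpow_le_self_of_one_le h (by norm_num)).trans (by linarith)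
  rw [Real.exp_neg, ← div_eq_mul_inv, div_le_one (Real.exp_pos _)]
  exact h1

/-- The truncated Laplace transforms are bounded, uniformly in the cutoff, by multiples of `p⁻¹`
and, after an integration by parts, of `p^(-1/4)`. -/
theorem exists_abs_integral_besselClifford_mul_exp_le :
    ∃ K : ℝ, 0 ≤ K ∧ ∀ Y : ℝ, 0 ≤ Y → ∀ p : ℝ, 0 < p →
      |∫ y in (0 : ℝ)..Y, besselClifford y * Real.exp (-(p * y))| ≤ K * p ^ (-1 : ℝ) ∧
      |∫ y in (0 : ℝ)..Y, besselClifford y * Real.exp (-(p * y))| ≤ K * p ^ (-(1 / 4) : ℝ) := by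
  obtain ⟨K, hK0, hB, hΦ⟩ := exists_besselClifford_bounds
  have hΓ : 0 < Real.Gamma (5 / 4) := Real.Gamma_pos_of_pos (by norm_num)
  refine ⟨K * (1 + Real.Gamma (5 / 4)), by positivity, fun Y hY p hp => ⟨?_, ?_⟩⟩
  · have h := norm_intervalIntegral_le_integral_Ioi (h := fun y => K * (y ^ 0 * Real.exp (-(p * y))))
      (f := fun y => besselClifford y * Real.exp (-(p * y))) hY (fun y hy => by
        rw [norm_mul, Real.norm_of_nonneg (Real.exp_pos _).le, pow_zero, one_mul]
        gcongr
        exact hB y hy.le) ((integrableOn_pow_mul_exp_neg_mul hp 0).const_mul K)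
    rw [integral_const_mul, integral_pow_mul_exp_neg_mul hp] at h
    refine h.trans ?_
    rw [Real.rpow_neg_one]
    simp only [zero_add, pow_one, Nat.factorial_zero, Nat.cast_one, mul_one]
    have : 0 < p⁻¹ := inv_pos.2 hp
    nlinarith [mul_nonneg (mul_nonneg hK0 hΓ.le) this.le]
  · have hparts := intervalIntegral.integral_mul_deriv_eq_deriv_mul (a := 0) (b := Y)
      (u := fun y => Real.exp (-(p * y))) (v := besselCliffordPrimitive)
      (u' := fun y => Real.exp (-(p * y)) * (-p)) (v' := besselClifford)
      (fun y _ => by simpa using ((hasDerivAt_id y).const_mul p).neg.exp)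
      (fun y _ => hasDerivAt_besselCliffordPrimitive y)
      ((by fun_prop : Continuous fun y => Real.exp (-(p * y)) * (-p)).intervalIntegrable _ _)
      (continuous_besselClifford.intervalIntegrable _ _)
    have h0 : besselCliffordPrimitive 0 = 0 := by simp [besselCliffordPrimitive]
    have hcomm : ∀ y, besselClifford y * Real.exp (-(p * y)) =
        Real.exp (-(p * y)) * besselClifford y := fun y => mul_comm _ _
    simp_rw [hcomm]
    rw [hparts, h0, mul_zero, sub_zero]
    have hint := integrableOn_rpow_mul_exp_neg_mul (v := 1 / 4) (by norm_num) hp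
    have h := norm_intervalIntegral_le_integral_Ioi
      (h := fun y => p * K * (y ^ (1 / 4 : ℝ) * Real.exp (-(p * y))))
      (f := fun y => Real.exp (-(p * y)) * (-p) * besselCliffordPrimitive y) hY (fun y hy => by
        rw [norm_mul, norm_mul, Real.norm_of_nonneg (Real.exp_pos _).le, norm_neg,
          Real.norm_of_nonneg hp.le]
        calc _ ≤ Real.exp (-(p * y)) * p * (K * y ^ (1 / 4 : ℝ)) := by
              gcongr
              exact hΦ y hy.le
          _ = _ := by ring) (hint.const_mul _)
    have hgam := Real.integral_rpow_mul_exp_neg_mul_Ioi (a := 5 / 4) (by norm_num) hp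
    rw [show (5 / 4 - 1 : ℝ) = 1 / 4 by norm_num] at hgam
    rw [integral_const_mul, hgam] at h
    have hpp : p * (1 / p) ^ (5 / 4 : ℝ) = p ^ (-(1 / 4) : ℝ) := by
      rw [one_div, Real.inv_rpow hp.le, ← Real.rpow_neg hp.le]
      nth_rewrite 1 [← Real.rpow_one p]
      rw [← Real.rpow_add hp]
      norm_num
    have hend : |Real.exp (-(p * Y)) * besselCliffordPrimitive Y| ≤ K * p ^ (-(1 / 4) : ℝ) := by
      rw [abs_mul, abs_of_pos (Real.exp_pos _)]
      calc _ ≤ Real.exp (-(p * Y)) * (K * Y ^ (1 / 4 : ℝ)) := by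
            gcongr
            exact hΦ Y hY
        _ = K * p ^ (-(1 / 4) : ℝ) * ((p * Y) ^ (1 / 4 : ℝ) * Real.exp (-(p * Y))) := by
            rw [Real.mul_rpow hp.le hY, Real.rpow_neg hp.le]
            have : p ^ (1 / 4 : ℝ) ≠ 0 := (Real.rpow_pos_of_pos hp _).ne'
            field_simp
        _ ≤ K * p ^ (-(1 / 4) : ℝ) * 1 := by
            gcongr
            exact rpow_quarter_mul_exp_neg_le (by positivity)
        _ = _ := mul_one _
    refine (abs_sub _ _).trans ((add_le_add hend h).trans_eq ?_)
    rw [← hpp]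
    ring

/-- The truncated Mellin transform `∫₀^Y B(y) y^s dy` of `besselClifford`. -/
noncomputable def truncatedMellin (Y : ℝ) (s : ℂ) : ℂ :=
  ∫ y in (0 : ℝ)..Y, (besselClifford y : ℂ) * (y : ℂ) ^ s

theorem intervalIntegrable_besselClifford_mul_cpow {s : ℂ} (hs : -1 < s.re) (a b : ℝ) :
    IntervalIntegrable (fun y : ℝ => (besselClifford y : ℂ) * (y : ℂ) ^ s) volume a b :=
  (intervalIntegral.intervalIntegrable_cpow' hs).continuousOn_mul
    (Complex.continuous_ofReal.comp continuous_besselClifford).continuousOn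

/-- Writing `Γ(-s) y^s` as an integral of `exp (-p y)` turns the truncated Mellin transform into an
integral of truncated Laplace transforms. -/
theorem Gamma_neg_mul_truncatedMellin {s : ℂ} (hs : -1 < s.re) (hs0 : s.re < 0) {Y : ℝ}
    (hY : 0 ≤ Y) :
    Complex.Gamma (-s) * truncatedMellin Y s =
      ∫ p in Set.Ioi (0 : ℝ), (p : ℂ) ^ (-s - 1) *
        ((∫ y in (0 : ℝ)..Y, besselClifford y * Real.exp (-(p * y)) : ℝ) : ℂ) := by
  have hsre : 0 < (-s).re := by simpa using hs0
  have hBc := continuous_besselClifford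
  have hinner : ∀ y ∈ Set.Ioc 0 Y,
      ∫ p in Set.Ioi (0 : ℝ), (besselClifford y : ℂ) *
        ((p : ℂ) ^ (-s - 1) * Complex.exp (-((y : ℂ) * p))) =
      Complex.Gamma (-s) * ((besselClifford y : ℂ) * (y : ℂ) ^ s) := by
    intro y hy
    rw [integral_const_mul, integral_cpow_mul_cexp_neg_mul hsre (by simpa using hy.1), neg_neg]
    ring
  have hprod : Integrable (Function.uncurry fun (y p : ℝ) => (besselClifford y : ℂ) *
      ((p : ℂ) ^ (-s - 1) * Complex.exp (-((y : ℂ) * p))))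
      ((volume.restrict (Set.Ioc 0 Y)).prod (volume.restrict (Set.Ioi 0))) := by
    have hmeas : Measurable (Function.uncurry fun (y p : ℝ) => (besselClifford y : ℂ) *
      ((p : ℂ) ^ (-s - 1) * Complex.exp (-((y : ℂ) * p)))) := by
      have := hBc.measurable
      unfold Function.uncurry
      fun_prop
    rw [integrable_prod_iff hmeas.aestronglyMeasurable]
    constructor
    · filter_upwards [ae_restrict_mem measurableSet_Ioc] with y hy
      exact (integrableOn_cpow_mul_cexp_neg_mul (a := -s - 1) (r := y) (by simpa using hs0)
        (by simpa using hy.1)).const_mul (besselClifford y : ℂ)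
    · have h1 : IntegrableOn (fun y : ℝ => |besselClifford y| * y ^ s.re * Real.Gamma (-s.re))
          (Set.Ioc 0 Y) := by
        refine Integrable.mul_const ?_ _
        rw [← IntegrableOn, ← intervalIntegrable_iff_integrableOn_Ioc_of_le hY]
        exact (intervalIntegral.intervalIntegrable_rpow' hs).continuousOn_mul hBc.abs.continuousOn
      refine h1.congr ?_
      filter_upwards [ae_restrict_mem measurableSet_Ioc] with y hy
      have h2 : ∀ p ∈ Set.Ioi (0 : ℝ), ‖(besselClifford y : ℂ) *
          ((p : ℂ) ^ (-s - 1) * Complex.exp (-((y : ℂ) * p)))‖ =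
          |besselClifford y| * (p ^ (-s.re - 1) * Real.exp (-(y * p))) := by
        intro p hp
        rw [norm_mul, norm_cpow_mul_cexp_neg_mul hp, Complex.norm_real, Real.norm_eq_abs]
        simp
      have hy0 : 0 < y := hy.1
      simp only [Function.uncurry]
      rw [setIntegral_congr_fun measurableSet_Ioi h2, integral_const_mul,
        Real.integral_rpow_mul_exp_neg_mul_Ioi (by linarith) hy0, one_div,
        Real.inv_rpow hy0.le, ← Real.rpow_neg hy0.le, neg_neg]
      ring
  rw [truncatedMellin, intervalIntegral.integral_of_le hY, ← integral_const_mul,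
    ← setIntegral_congr_fun measurableSet_Ioc hinner, integral_integral_swap hprod]
  refine setIntegral_congr_fun measurableSet_Ioi fun p _ => ?_
  rw [intervalIntegral.integral_of_le hY, ← integral_complex_ofReal, ← integral_const_mul]
  refine integral_congr_ae (Eventually.of_forall fun y => ?_)
  push_cast
  ring_nf

theorem integral_cpow_mul_inv_mul_exp_neg_inv {s : ℂ} (hs : -1 < s.re) :
    ∫ p in Set.Ioi (0 : ℝ), (p : ℂ) ^ (-s - 1) * ((p⁻¹ * Real.exp (-p⁻¹) : ℝ) : ℂ) =
      Complex.Gamma (s + 1) := by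
  have h := mellin_comp_inv (fun t : ℝ => ((t * Real.exp (-t) : ℝ) : ℂ)) (-s)
  simp only [mellin, smul_eq_mul, neg_neg] at h
  rw [h, Complex.Gamma_eq_integral (by simpa using by linarith), Complex.GammaIntegral]
  refine setIntegral_congr_fun measurableSet_Ioi fun t (ht : 0 < t) => ?_
  have ht0 : (t : ℂ) ≠ 0 := by exact_mod_cast ht.ne'
  simp only [add_sub_cancel_right]
  rw [Complex.cpow_sub _ _ ht0, Complex.cpow_one]
  push_cast
  field_simp

/-- The Mellin transform of `besselClifford` is `Γ(s + 1) / Γ(-s)`. It converges only conditionally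
when `-3/4 ≤ Re s`; the limit is taken in the absolutely convergent `p`-integral of
`Gamma_neg_mul_truncatedMellin`. -/
theorem tendsto_truncatedMellin {s : ℂ} (hs : -1 < s.re) (hs4 : s.re < -(1 / 4)) :
    Tendsto (fun Y => Complex.Gamma (-s) * truncatedMellin Y s) atTop
      (𝓝 (Complex.Gamma (s + 1))) := by
  obtain ⟨K, hK0, hK⟩ := exists_abs_integral_besselClifford_mul_exp_le
  rw [← integral_cpow_mul_inv_mul_exp_neg_inv hs]
  have hcongr : ∀ᶠ Y in atTop, ∫ p in Set.Ioi (0 : ℝ), (p : ℂ) ^ (-s - 1) *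
        ((∫ y in (0 : ℝ)..Y, besselClifford y * Real.exp (-(p * y)) : ℝ) : ℂ) =
      Complex.Gamma (-s) * truncatedMellin Y s := by
    filter_upwards [eventually_ge_atTop 0] with Y hY
    exact (Gamma_neg_mul_truncatedMellin hs (by linarith) hY).symm
  refine Tendsto.congr' hcongr ?_
  -- near `0` use the bound `p^(-1/4)`, near `∞` the bound `p⁻¹`
  set bound : ℝ → ℝ := fun p =>
    if p ≤ 1 then K * p ^ (-s.re - 1 + -(1 / 4)) else K * p ^ (-s.re - 1 + -1) with hbdef
  have hbound : IntegrableOn bound (Set.Ioi 0) := by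
    rw [← Set.Ioc_union_Ioi_eq_Ioi zero_le_one, integrableOn_union]
    constructor
    · have h1 : IntegrableOn (fun p : ℝ => K * p ^ (-s.re - 1 + -(1 / 4))) (Set.Ioc 0 1) := by
        rw [← intervalIntegrable_iff_integrableOn_Ioc_of_le zero_le_one]
        exact (intervalIntegral.intervalIntegrable_rpow' (by linarith)).const_mul K
      refine h1.congr_fun (fun p hp => ?_) measurableSet_Ioc
      simp [hbdef, hp.2]
    · have h1 : IntegrableOn (fun p : ℝ => K * p ^ (-s.re - 1 + -1)) (Set.Ioi 1) :=
        (integrableOn_Ioi_rpow_of_lt (by linarith) one_pos).const_mul K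
      refine h1.congr_fun (fun p (hp : 1 < p) => ?_) measurableSet_Ioi
      simp [hbdef, hp]
  refine tendsto_integral_filter_of_dominated_convergence bound ?_ ?_ hbound ?_
  · refine Eventually.of_forall fun Y => ?_
    have hL : Continuous fun p : ℝ => ∫ y in (0 : ℝ)..Y, besselClifford y * Real.exp (-(p * y)) := by
      have hBc := continuous_besselClifford
      refine intervalIntegral.continuous_parametric_intervalIntegral_of_continuous' ?_ _ _
      unfold Function.uncurry
      fun_prop
    have := hL.measurable
    exact (by fun_prop : Measurable _).aestronglyMeasurable
  · filter_upwards [eventually_ge_atTop 0] with Y hY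
    filter_upwards [ae_restrict_mem measurableSet_Ioi] with p (hp : 0 < p)
    obtain ⟨h1, h2⟩ := hK Y hY p hp
    rw [norm_mul, Complex.norm_cpow_eq_rpow_re_of_pos hp, Complex.norm_real, Real.norm_eq_abs]
    simp only [Complex.sub_re, Complex.neg_re, Complex.one_re, hbdef]
    have h3 : 0 ≤ p ^ (-s.re - 1) := Real.rpow_nonneg hp.le _
    split_ifs
    · rw [Real.rpow_add hp, mul_left_comm]
      gcongr
    · rw [Real.rpow_add hp, mul_left_comm]
      gcongr
  · filter_upwards [ae_restrict_mem measurableSet_Ioi] with p (hp : 0 < p)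
    have h := tendsto_integral_besselClifford_mul_exp hp
    exact ((Complex.continuous_ofReal.tendsto _).comp h).const_mul _

/-- The truncated Mellin transforms grow at most linearly on a vertical line, uniformly in the
cutoff. -/
theorem exists_norm_truncatedMellin_le {v : ℝ} (hv : -1 < v) (hv4 : v < -(1 / 4)) :
    ∃ K : ℝ, 0 ≤ K ∧ ∀ Y : ℝ, 1 ≤ Y → ∀ s : ℂ, s.re = v →
      ‖truncatedMellin Y s‖ ≤ K * (1 + ‖s‖) := by
  obtain ⟨K, hK0, hB, hΦ⟩ := exists_besselClifford_bounds
  have hint0 : IntegrableOn (fun y : ℝ => y ^ v) (Set.Ioc 0 1) := by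
    rw [← intervalIntegrable_iff_integrableOn_Ioc_of_le zero_le_one]
    exact intervalIntegral.intervalIntegrable_rpow' hv
  have hint1 : IntegrableOn (fun y : ℝ => y ^ (1 / 4 + (v - 1))) (Set.Ioi 1) :=
    integrableOn_Ioi_rpow_of_lt (by linarith) one_pos
  set I₀ := ∫ y in Set.Ioc (0 : ℝ) 1, y ^ v
  set I₁ := ∫ y in Set.Ioi (1 : ℝ), y ^ (1 / 4 + (v - 1))
  have hI₀ : 0 ≤ I₀ := setIntegral_nonneg measurableSet_Ioc fun y hy => Real.rpow_nonneg hy.1.le _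
  have hI₁ : 0 ≤ I₁ := setIntegral_nonneg measurableSet_Ioi fun y (hy : 1 < y) =>
    Real.rpow_nonneg (by linarith) _
  refine ⟨K * (I₀ + 2 + I₁), by positivity, fun Y hY s hs => ?_⟩
  have hs1 : -1 < s.re := hs ▸ hv
  have hsplit : truncatedMellin Y s = (∫ y in (0 : ℝ)..1, (besselClifford y : ℂ) * (y : ℂ) ^ s) +
      ∫ y in (1 : ℝ)..Y, (besselClifford y : ℂ) * (y : ℂ) ^ s :=
    (intervalIntegral.integral_add_adjacent_intervals
      (intervalIntegrable_besselClifford_mul_cpow hs1 _ _)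
      (intervalIntegrable_besselClifford_mul_cpow hs1 _ _)).symm
  have hpart0 : ‖∫ y in (0 : ℝ)..1, (besselClifford y : ℂ) * (y : ℂ) ^ s‖ ≤ K * I₀ := by
    rw [intervalIntegral.integral_of_le zero_le_one, ← integral_const_mul]
    refine norm_integral_le_of_norm_le (hint0.const_mul K) ?_
    filter_upwards [ae_restrict_mem measurableSet_Ioc] with y hy
    rw [norm_mul, Complex.norm_cpow_eq_rpow_re_of_pos hy.1, hs, Complex.norm_real]
    exact mul_le_mul_of_nonneg_right (hB y hy.1.le) (Real.rpow_nonneg hy.1.le _)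
  have hpos : ∀ y ∈ Set.uIcc 1 Y, 0 < y := fun y hy => by
    rw [Set.uIcc_of_le hY] at hy
    linarith [hy.1]
  have hs0 : s ≠ 0 := by
    rintro rfl
    simp only [Complex.zero_re] at hs
    linarith
  have hcpow : ContinuousOn (fun y : ℝ => s * (y : ℂ) ^ (s - 1)) (Set.uIcc 1 Y) := by
    refine continuousOn_const.mul ?_
    exact ContinuousOn.cpow_const Complex.continuous_ofReal.continuousOn
      fun y hy => Or.inl (by simpa using hpos y hy)
  have hparts := intervalIntegral.integral_mul_deriv_eq_deriv_mul (a := 1) (b := Y)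
      (u := fun y : ℝ => (y : ℂ) ^ s) (v := fun y => (besselCliffordPrimitive y : ℂ))
      (u' := fun y : ℝ => s * (y : ℂ) ^ (s - 1)) (v' := fun y => (besselClifford y : ℂ))
      (fun y hy => hasDerivAt_ofReal_cpow_const (hpos y hy).ne' hs0)
      (fun y _ => (hasDerivAt_besselCliffordPrimitive y).ofReal_comp)
      hcpow.intervalIntegrable
      ((Complex.continuous_ofReal.comp continuous_besselClifford).intervalIntegrable _ _)
  have hend : ∀ y : ℝ, 1 ≤ y → ‖(y : ℂ) ^ s * (besselCliffordPrimitive y : ℂ)‖ ≤ K := by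
    intro y hy
    have hy0 : 0 < y := by linarith
    rw [norm_mul, Complex.norm_cpow_eq_rpow_re_of_pos hy0, hs, Complex.norm_real]
    calc y ^ v * |besselCliffordPrimitive y| ≤ y ^ v * (K * y ^ (1 / 4 : ℝ)) := by
          gcongr
          exact hΦ y hy0.le
      _ = K * y ^ (v + 1 / 4) := by rw [Real.rpow_add hy0]; ring
      _ ≤ K * 1 := by
          gcongr
          exact Real.rpow_le_one_of_one_le_of_nonpos hy (by linarith)
      _ = K := mul_one K
  have hpart1 : ‖∫ y in (1 : ℝ)..Y, s * (y : ℂ) ^ (s - 1) * (besselCliffordPrimitive y : ℂ)‖ ≤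
      ‖s‖ * K * I₁ := by
    rw [← integral_const_mul]
    refine norm_intervalIntegral_le_integral_Ioi hY (fun y hy => ?_) (hint1.const_mul _)
    have hy0 : 0 < y := by linarith
    rw [norm_mul, norm_mul, Complex.norm_cpow_eq_rpow_re_of_pos hy0, Complex.norm_real,
      Complex.sub_re, hs, Complex.one_re, Real.rpow_add hy0]
    calc ‖s‖ * y ^ (v - 1) * |besselCliffordPrimitive y|
        ≤ ‖s‖ * y ^ (v - 1) * (K * y ^ (1 / 4 : ℝ)) := by
          gcongr
          exact hΦ y hy0.le
      _ = _ := by ring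
  have hcomm : ∀ y : ℝ, (besselClifford y : ℂ) * (y : ℂ) ^ s =
      (y : ℂ) ^ s * (besselClifford y : ℂ) := fun y => mul_comm _ _
  simp_rw [hcomm] at hsplit hpart0
  rw [hsplit, hparts]
  have h1 := hend Y hY
  have h2 := hend 1 le_rfl
  calc _ ≤ K * I₀ + (K + K + ‖s‖ * K * I₁) := by
        refine (norm_add_le _ _).trans (add_le_add hpart0 ?_)
        refine (norm_sub_le _ _).trans (add_le_add ?_ hpart1)
        exact (norm_sub_le _ _).trans (add_le_add h1 h2)
    _ ≤ K * (I₀ + 2 + I₁) * (1 + ‖s‖) := by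
        have hns := norm_nonneg s
        nlinarith [mul_nonneg (mul_nonneg hK0 hI₀) hns, mul_nonneg hK0 hns, mul_nonneg hK0 hI₁]

/-! ### The Hankel transform as a vertical line integral -/

theorem ofReal_mul_cpow {c y : ℝ} (hc : 0 < c) (hy : 0 < y) (s : ℂ) :
    ((c * y : ℝ) : ℂ) ^ s = (c : ℂ) ^ s * (y : ℂ) ^ s := by
  rw [Complex.ofReal_mul, Complex.mul_cpow_ofReal_nonneg hc.le hy.le]

theorem integrable_prod_besselClifford_mul {δ : ℝ} (hδ1 : δ < 1) {H : ℝ → ℂ} (hH : Integrable H)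
    {Y : ℝ} (hY : 0 ≤ Y) :
    Integrable (Function.uncurry fun (y w : ℝ) => H w *
      ((besselClifford y : ℂ) * (y : ℂ) ^ (((-δ : ℝ) : ℂ) + (w : ℂ) * Complex.I)))
      ((volume.restrict (Set.Ioc 0 Y)).prod volume) := by
  have hBc := continuous_besselClifford
  have h1 : IntegrableOn (fun y : ℝ => |besselClifford y| * y ^ (-δ)) (Set.Ioc 0 Y) := by
    rw [← intervalIntegrable_iff_integrableOn_Ioc_of_le hY]
    exact (intervalIntegral.intervalIntegrable_rpow' (by linarith)).continuousOn_mul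
      hBc.abs.continuousOn
  refine (h1.mul_prod hH.norm).mono' ?_ ?_
  · refine AEStronglyMeasurable.mul hH.aestronglyMeasurable.comp_snd ?_
    have := hBc.measurable
    exact (by fun_prop : Measurable fun z : ℝ × ℝ => (besselClifford z.1 : ℂ) *
      (z.1 : ℂ) ^ (((-δ : ℝ) : ℂ) + (z.2 : ℂ) * Complex.I)).aestronglyMeasurable
  · have hpos : ∀ᵐ z : ℝ × ℝ ∂((volume.restrict (Set.Ioc 0 Y)).prod volume), 0 < z.1 := by
      refine Measure.quasiMeasurePreserving_fst.ae (p := fun y : ℝ => 0 < y) ?_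
      filter_upwards [ae_restrict_mem measurableSet_Ioc] with y hy using hy.1
    filter_upwards [hpos] with z hz
    simp only [Function.uncurry]
    rw [norm_mul, norm_mul, Complex.norm_cpow_eq_rpow_re_of_pos hz, Complex.norm_real,
      Real.norm_eq_abs]
    simp [mul_comm]

/-- Fubini's theorem, on a bounded range of `y`, for the Mellin–Barnes integral tested against
`besselClifford`. -/
theorem integral_besselClifford_mul_mellinBarnes {δ A P C : ℝ} (hδ : 0 < δ) (hδ1 : δ < 1)
    (hA : A < Real.pi / 2) {φ : ℂ → ℂ} (hφ : ExpBounded δ A P C φ) {c Y : ℝ} (hc : 0 < c)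
    (hY : 0 ≤ Y) :
    ∫ y in (0 : ℝ)..Y, (besselClifford y : ℂ) * mellinBarnes δ φ (c * y) =
      (2 * (Real.pi : ℂ))⁻¹ * ∫ w : ℝ,
        Complex.Gamma (-((-δ : ℝ) + (w : ℂ) * Complex.I)) * φ ((-δ : ℝ) + (w : ℂ) * Complex.I) *
        (c : ℂ) ^ (((-δ : ℝ) : ℂ) + (w : ℂ) * Complex.I) *
        truncatedMellin Y (((-δ : ℝ) : ℂ) + (w : ℂ) * Complex.I) := by
  have hint := integrable_prod_besselClifford_mul hδ1 (integrable_mellinBarnes hδ hA hφ hc) hY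
  simp only [truncatedMellin, intervalIntegral.integral_of_le hY, ← integral_const_mul]
  simp only [integral_const_mul (2 * (Real.pi : ℂ))⁻¹]
  rw [← integral_integral_swap hint, ← integral_const_mul]
  refine setIntegral_congr_fun measurableSet_Ioc fun y hy => ?_
  have hy0 : 0 < y := hy.1
  simp only [mellinBarnes, ofReal_mul_cpow hc hy0]
  rw [mul_left_comm, ← integral_const_mul]
  congr 1
  refine integral_congr_ae (Eventually.of_forall fun w => ?_)
  ring

theorem integrable_one_add_abs_mul_exp {ε a : ℝ} (hε : 0 < ε) :
    Integrable fun w : ℝ => (a + |w|) * Real.exp (-(ε * |w|)) := by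
  have hε2 : 0 < ε / 2 := by positivity
  have h := (integrable_exp_neg_mul_abs hε2).const_mul (|a| + 2 / ε)
  refine h.mono' (by fun_prop) (Eventually.of_forall fun w => ?_)
  have h1 : |w| ≤ 2 / ε * Real.exp (ε / 2 * |w|) := by
    have h2 := Real.add_one_le_exp (ε / 2 * |w|)
    calc |w| = 2 / ε * (ε / 2 * |w|) := by field_simp
      _ ≤ _ := by gcongr; linarith
  have h3 : |a| ≤ |a| * Real.exp (ε / 2 * |w|) :=
    le_mul_of_one_le_right (abs_nonneg a) (Real.one_le_exp (by positivity))
  rw [norm_mul, Real.norm_of_nonneg (Real.exp_pos _).le, Real.norm_eq_abs]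
  calc abs (a + abs w) * Real.exp (-(ε * |w|))
      ≤ ((|a| + 2 / ε) * Real.exp (ε / 2 * |w|)) * Real.exp (-(ε * |w|)) := by
        gcongr
        refine (abs_add_le _ _).trans ?_
        rw [abs_abs]
        linarith
    _ = _ := by
        rw [mul_assoc, ← Real.exp_add]
        ring_nf

/-- The linear growth of `truncatedMellin` along the line is absorbed by the exponential decay of
`Γ(-s) φ(s)`, so the limit may be taken under the integral. This needs `δ > 1 / 4`, that is, a line
in the region where the Mellin transform of `besselClifford` converges. -/
theorem tendsto_integral_besselClifford_mul_mellinBarnes {δ A P C : ℝ} (hδ : 1 / 4 < δ)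
    (hδ1 : δ < 1) (hA : A < Real.pi / 2) {φ : ℂ → ℂ} (hφ : ExpBounded δ A P C φ) {c : ℝ}
    (hc : 0 < c) :
    Tendsto (fun Y : ℝ => ∫ y in (0 : ℝ)..Y, (besselClifford y : ℂ) * mellinBarnes δ φ (c * y))
      atTop (𝓝 ((2 * (Real.pi : ℂ))⁻¹ * ∫ w : ℝ,
        φ ((-δ : ℝ) + (w : ℂ) * Complex.I) *
        Complex.Gamma (((-δ : ℝ) + (w : ℂ) * Complex.I) + 1) *
        (c : ℂ) ^ (((-δ : ℝ) : ℂ) + (w : ℂ) * Complex.I))) := by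
  have hδ0 : 0 < δ := by linarith
  have hcongr : ∀ᶠ Y : ℝ in atTop, (2 * (Real.pi : ℂ))⁻¹ * (∫ w : ℝ,
        Complex.Gamma (-((-δ : ℝ) + (w : ℂ) * Complex.I)) * φ ((-δ : ℝ) + (w : ℂ) * Complex.I) *
        (c : ℂ) ^ (((-δ : ℝ) : ℂ) + (w : ℂ) * Complex.I) *
        truncatedMellin Y (((-δ : ℝ) : ℂ) + (w : ℂ) * Complex.I)) =
      ∫ y in (0 : ℝ)..Y, (besselClifford y : ℂ) * mellinBarnes δ φ (c * y) := by
    filter_upwards [eventually_ge_atTop 0] with Y hY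
    exact (integral_besselClifford_mul_mellinBarnes hδ0 hδ1 hA hφ hc hY).symm
  refine Tendsto.congr' hcongr (Tendsto.const_mul _ ?_)
  obtain ⟨K₁, hK₁, hM⟩ := exists_norm_truncatedMellin_le (v := -δ) (by linarith) (by linarith)
  obtain ⟨ε, hε, K, -, hK⟩ := exists_norm_Gamma_mul_cpow_le (P := P) (a := -δ) (b := -δ)
    (u := δ) hA hc hδ0
  refine tendsto_integral_filter_of_dominated_convergence
    (fun w : ℝ => C * K * K₁ * ((1 + δ + |w|) * Real.exp (-(ε * |w|)))) ?_ ?_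
    ((integrable_one_add_abs_mul_exp hε).const_mul _) ?_
  · filter_upwards [eventually_ge_atTop 0] with Y hY
    have h := (integrable_prod_besselClifford_mul hδ1 (integrable_mellinBarnes hδ0 hA hφ hc)
      hY).integral_prod_right
    simp only [Function.uncurry, ← intervalIntegral.integral_of_le hY,
      intervalIntegral.integral_const_mul] at h
    exact h.aestronglyMeasurable
  · filter_upwards [eventually_ge_atTop 1] with Y hY
    refine Eventually.of_forall fun w => ?_
    have h1 := hK C _ (((-δ : ℝ) : ℂ) + (w : ℂ) * Complex.I)
      (-(((-δ : ℝ) : ℂ) + (w : ℂ) * Complex.I))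
      (hφ.bound _ (by simp)) (by simp) (by simp) (by simp) (by simp) (by simp)
    have h2 := hM Y hY (((-δ : ℝ) : ℂ) + (w : ℂ) * Complex.I) (by simp)
    have h3 : ‖((-δ : ℝ) : ℂ) + (w : ℂ) * Complex.I‖ ≤ δ + |w| := by
      refine (norm_add_le _ _).trans ?_
      simp [abs_of_pos hδ0]
    rw [norm_mul]
    simp only [Complex.add_im, Complex.ofReal_im, Complex.mul_im, Complex.ofReal_re, Complex.I_im,
      mul_one, Complex.I_re, mul_zero, add_zero, zero_add] at h1
    calc _ ≤ (C * K * Real.exp (-(ε * |w|))) * (K₁ * (1 + (δ + |w|))) := by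
          refine mul_le_mul h1 (h2.trans ?_) (norm_nonneg _) ((norm_nonneg _).trans h1)
          gcongr
      _ = _ := by ring
  · refine Eventually.of_forall fun w => ?_
    have h := tendsto_truncatedMellin (s := ((-δ : ℝ) : ℂ) + (w : ℂ) * Complex.I)
      (by simpa using hδ1) (by simpa using hδ)
    have h2 := h.const_mul (φ ((-δ : ℝ) + (w : ℂ) * Complex.I) *
      (c : ℂ) ^ (((-δ : ℝ) : ℂ) + (w : ℂ) * Complex.I))
    convert h2 using 2
    all_goals ring

/-- The integrand `φ(s) Γ(s + 1) c^s` is holomorphic for `-1 < Re s`, so its line of integration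
may be moved anywhere in `-δ ≤ Re s`. -/
theorem integral_Gamma_add_one_line {δ A P C : ℝ} (hδ1 : δ < 1)
    (hA : A < Real.pi / 2) {φ : ℂ → ℂ} (hφ : ExpBounded δ A P C φ) {c : ℝ} (hc : 0 < c) {α : ℝ}
    (hα : -δ ≤ α) :
    (Integrable fun w : ℝ => φ ((α : ℂ) + (w : ℂ) * Complex.I) *
        Complex.Gamma (((α : ℂ) + (w : ℂ) * Complex.I) + 1) *
        (c : ℂ) ^ ((α : ℂ) + (w : ℂ) * Complex.I)) ∧
    ∫ w : ℝ, φ ((-δ : ℝ) + (w : ℂ) * Complex.I) *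
        Complex.Gamma (((-δ : ℝ) + (w : ℂ) * Complex.I) + 1) *
        (c : ℂ) ^ (((-δ : ℝ) : ℂ) + (w : ℂ) * Complex.I) =
      ∫ w : ℝ, φ ((α : ℂ) + (w : ℂ) * Complex.I) *
        Complex.Gamma (((α : ℂ) + (w : ℂ) * Complex.I) + 1) *
        (c : ℂ) ^ ((α : ℂ) + (w : ℂ) * Complex.I) := by
  obtain ⟨ε, hε, K, -, hK⟩ := exists_norm_Gamma_mul_cpow_le (P := P) (a := -δ) (b := α)
    (l := 1 - δ) (u := 1 + α) hA hc (by linarith)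
  set F : ℂ → ℂ := fun s => φ s * Complex.Gamma (s + 1) * (c : ℂ) ^ s with hF
  have hFd : DifferentiableOn ℂ F {s : ℂ | -δ ≤ s.re ∧ s.re ≤ α} := by
    intro s hs
    refine DifferentiableAt.differentiableWithinAt ?_
    refine DifferentiableAt.mul (DifferentiableAt.mul (hφ.analytic s hs.1).differentiableAt ?_)
      (differentiable_const_cpow hc s)
    refine DifferentiableAt.comp s (differentiableAt_Gamma_of_re_pos ?_)
      (differentiableAt_id.add_const 1)
    have := hs.1
    simp only [Complex.add_re, Complex.one_re]
    linarith
  have hb : ∀ s : ℂ, -δ ≤ s.re → s.re ≤ α → ‖F s‖ ≤ C * K * Real.exp (-(ε * |s.im|)) := by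
    intro s h1 h2
    have h := hK C (φ s) s (s + 1) (hφ.bound s h1) h1 h2
      (by simp only [Complex.add_re, Complex.one_re]; linarith)
      (by simp only [Complex.add_re, Complex.one_re]; linarith) (by simp)
    rwa [mul_comm (Complex.Gamma (s + 1))] at h
  have hint : ∀ v : ℝ, -δ ≤ v → v ≤ α →
      Integrable fun w : ℝ => F ((v : ℂ) + (w : ℂ) * Complex.I) := by
    intro v h1 h2
    refine integrable_vertical_line_of_le hε
      (continuous_comp_vertical_line hFd.continuousOn h1 h2) (K := C * K) fun w => ?_
    have := hb ((v : ℂ) + (w : ℂ) * Complex.I) (by simpa using h1) (by simpa using h2)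
    simpa using this
  refine ⟨hint α hα le_rfl, ?_⟩
  have hB : Tendsto (fun t : ℝ => C * K * Real.exp (-(ε * t))) atTop (𝓝 0) := by
    have h1 : Tendsto (fun t : ℝ => ε * t) atTop atTop := tendsto_id.const_mul_atTop hε
    simpa using (Real.tendsto_exp_neg_atTop_nhds_zero.comp h1).const_mul (C * K)
  exact integral_vertical_line_eq hα hFd hB (fun s h1 h2 _ => hb s h1 h2)
    (hint (-δ) le_rfl hα) (hint α hα le_rfl)

/-- The substitution `y = q² x² / 4`. -/
theorem integral_besselJZero_eq {g : ℂ → ℂ} (hg : ∀ x : ℝ, 0 ≤ x → ContinuousAt g (x : ℂ))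
    {q : ℝ} (hq : 0 < q) (R : ℝ) :
    ∫ x in (0 : ℝ)..R, (besselJZero (q * x) : ℂ) * g ((x : ℂ) ^ 2) * (x : ℂ) =
      2 / (q : ℂ) ^ 2 * ∫ y in (0 : ℝ)..(q ^ 2 / 4 * R ^ 2),
        (besselClifford y : ℂ) * g ((4 / q ^ 2 * y : ℝ) : ℂ) := by
  have hq0 : (q : ℂ) ≠ 0 := by exact_mod_cast hq.ne'
  have h := intervalIntegral.integral_deriv_smul_comp' (a := 0) (b := R)
    (f := fun x : ℝ => q ^ 2 / 4 * x ^ 2) (f' := fun x : ℝ => q ^ 2 / 4 * (2 * x))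
    (g := fun y : ℝ => (besselClifford y : ℂ) * g ((4 / q ^ 2 * y : ℝ) : ℂ))
    (fun x _ => by simpa using (hasDerivAt_pow 2 x).const_mul (q ^ 2 / 4)) (by fun_prop) (by
      rintro _ ⟨x, -, rfl⟩
      refine ContinuousAt.continuousWithinAt (ContinuousAt.mul ?_ ?_)
      · exact (Complex.continuous_ofReal.comp continuous_besselClifford).continuousAt
      · refine ContinuousAt.comp (f := fun y : ℝ => ((4 / q ^ 2 * y : ℝ) : ℂ))
          (hg _ (by positivity)) ?_
        exact (by fun_prop : Continuous fun y : ℝ => ((4 / q ^ 2 * y : ℝ) : ℂ)).continuousAt)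
  simp only [ne_eq, OfNat.ofNat_ne_zero, not_false_eq_true, zero_pow, mul_zero] at h
  rw [← h, ← intervalIntegral.integral_const_mul]
  refine intervalIntegral.integral_congr fun x _ => ?_
  have e1 : 4 / q ^ 2 * (q ^ 2 / 4 * x ^ 2) = x ^ 2 := by field_simp
  have e2 : q ^ 2 / 4 * x ^ 2 = (q * x) ^ 2 / 4 := by ring
  simp only [Function.comp, Complex.real_smul]
  rw [e1, besselJZero_eq_besselClifford, e2]
  push_cast
  field_simp
  ring

theorem intervalIntegrable_hankel {g : ℂ → ℂ} (hg : ∀ x : ℝ, 0 ≤ x → ContinuousAt g (x : ℂ))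
    (q R : ℝ) :
    IntervalIntegrable (fun x : ℝ => (besselJZero (q * x) : ℂ) * g ((x : ℂ) ^ 2) * (x : ℂ))
      volume 0 R := by
  refine Continuous.intervalIntegrable ?_ _ _
  simp_rw [besselJZero_eq_besselClifford]
  have h1 := continuous_besselClifford
  have h2 : Continuous fun x : ℝ => g ((x : ℂ) ^ 2) := by
    refine continuous_iff_continuousAt.2 fun x => ?_
    refine ContinuousAt.comp (f := fun y : ℝ => (y : ℂ) ^ 2) ?_
      (by fun_prop : Continuous fun y : ℝ => (y : ℂ) ^ 2).continuousAt
    have := hg (x ^ 2) (sq_nonneg x)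
    push_cast at this
    exact this
  have h3 : Continuous fun x : ℝ => (besselClifford ((q * x) ^ 2 / 4) : ℂ) :=
    Complex.continuous_ofReal.comp (h1.comp (by fun_prop))
  exact (h3.mul h2).mul Complex.continuous_ofReal

theorem theorem1
    (g gbar : ℂ → ℂ) (d δ C P A : ℝ)
    (hg : ∀ x : ℝ, 0 ≤ x → AnalyticAt ℂ g (x : ℂ))
    (hTaylor : ∀ᶠ z : ℂ in 𝓝 0,
      HasSum (fun m : ℕ => gbar (m : ℂ) / (Nat.factorial m : ℂ) * (-z) ^ m) (g z))
    (hd : 1 / 4 < d)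
    (hdecay : (fun x : ℝ => g (x : ℂ)) =O[atTop] fun x : ℝ => x ^ (-d))
    (hδ : 1 / 4 < δ) (hδ1 : δ < 1)
    (hgbar : AnalyticOnNhd ℂ gbar {s : ℂ | -δ ≤ s.re})
    (hA : A < Real.pi / 2)
    (hgrowth : ∀ s : ℂ, -δ ≤ s.re → ‖gbar s‖ < C * Real.exp (P * s.re + A * |s.im|))
    (q : ℝ) (hq : 0 < q) (α : ℝ) (hαδ : -δ ≤ α) (hα : -1 < α ∧ α < 0) :
    VerticalLineIntegrable
      (fun s : ℂ => gbar s * Complex.Gamma (s + 1) * ((q : ℂ) ^ 2 / 4) ^ (-s)) α ∧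
    HasHankelTransformZero (fun x : ℝ => g ((x : ℂ) ^ 2)) q
      (1 / ((Real.pi : ℂ) * Complex.I * (q : ℂ) ^ 2) *
        verticalLineIntegral
          (fun s : ℂ => gbar s * Complex.Gamma (s + 1) * ((q : ℂ) ^ 2 / 4) ^ (-s)) α) := by
  have hφ : ExpBounded δ A P C gbar := ⟨hgbar, fun s hs => (hgrowth s hs).le⟩
  have hc : 0 < 4 / q ^ 2 := by positivity
  have hpow : ∀ s : ℂ, ((q : ℂ) ^ 2 / 4) ^ (-s) = ((4 / q ^ 2 : ℝ) : ℂ) ^ s := by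
    intro s
    have hq4 : 0 ≤ q ^ 2 / 4 := by positivity
    have e1 : ((q : ℂ) ^ 2 / 4) = ((q ^ 2 / 4 : ℝ) : ℂ) := by push_cast; rfl
    rw [e1, Complex.cpow_neg, ← Complex.inv_cpow, ← Complex.ofReal_inv, inv_div]
    rw [Complex.arg_ofReal_of_nonneg hq4]
    exact Real.pi_pos.ne
  have hgc : ∀ x : ℝ, 0 ≤ x → ContinuousAt g (x : ℂ) := fun x hx => (hg x hx).continuousAt
  obtain ⟨hint, hshift⟩ := integral_Gamma_add_one_line hδ1 hA hφ hc hαδ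
  simp only [VerticalLineIntegrable, HasHankelTransformZero, verticalLineIntegral, hpow]
  refine ⟨hint, fun R _ => intervalIntegrable_hankel hgc q R, ?_⟩
  have hlim := tendsto_integral_besselClifford_mul_mellinBarnes hδ hδ1 hA hφ hc
  rw [hshift] at hlim
  have hR : Tendsto (fun R : ℝ => q ^ 2 / 4 * R ^ 2) atTop atTop :=
    (tendsto_pow_atTop two_ne_zero).const_mul_atTop (by positivity)
  have hlim2 := (hlim.comp hR).const_mul (2 / (q : ℂ) ^ 2)
  have hval : ∀ J : ℂ, 1 / ((Real.pi : ℂ) * Complex.I * (q : ℂ) ^ 2) * (Complex.I * J) =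
      2 / (q : ℂ) ^ 2 * ((2 * (Real.pi : ℂ))⁻¹ * J) := by
    intro J
    have hq0 : (q : ℂ) ≠ 0 := by exact_mod_cast hq.ne'
    have hpi : (Real.pi : ℂ) ≠ 0 := by exact_mod_cast Real.pi_ne_zero
    field_simp
  rw [hval]
  refine hlim2.congr fun R => ?_
  rw [integral_besselJZero_eq hgc hq R, Function.comp]
  congr 1
  have hY : 0 ≤ q ^ 2 / 4 * R ^ 2 := by positivity
  rw [intervalIntegral.integral_of_le hY, intervalIntegral.integral_of_le hY]
  refine setIntegral_congr_fun measurableSet_Ioc fun y hy => ?_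
  rw [eq_mellinBarnes (by linarith) hδ1 hA hφ hg hTaylor (mul_pos hc hy.1)]
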